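/- Let $G$ be a profinite group (a compact, Hausdorff, totally disconnected topological group) and let $X$ be a profinite $G$-space, i.e. a compact, Hausdorff, totally disconnected space with a continuous action of $G$. Put $X^{(0)}=X$, let $X^{(\alpha+1)}$ be $X^{(\alpha)}$ with its isolated points removed, and let $X^{(\lambda)}=\bigcap_{\alpha<\lambda}X^{(\alpha)}$ for limit ordinals $\lambda$. The Cantor--Bendixson rank of $X$ is the least ordinal $\alpha$ with $X^{(\alpha)}=X^{(\beta)}$ for all $\beta\ge\alpha$, and $X$ is scattered if $X^{(\alpha)}=\emptyset$ for this $\alpha$. A rational $G$-sheaf over $X$ is a local homeomorphism $p\colon E\to X$ whose fibres are $\mathbb{Q}$-vector spaces with continuous fibrewise addition $E\times_X E\to E$ and continuous fibrewise multiplication by each rational number, together with a continuous action of $G$ on $E$ such that $p$ is $G$-equivariant and each map $g\colon p^{-1}(x)\to p^{-1}(gx)$ is $\mathbb{Q}$-linear. A map of rational $G$-sheaves is a continuous $G$-equivariant map over $X$ which is $\mathbb{Q}$-linear on fibres. The category of rational $G$-sheaves over $X$ is abelian; its homological dimension (also called injective dimension) is the supremum of the injective dimensions of its objects, where a zero object has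 dimension $-\infty$. Suppose that $X$ is scattered of finite Cantor--Bendixson rank $n\in\mathbb{N}$ ($n=0$ exactly when $X=\emptyset$). Then the category of rational $G$-sheaves over $X$ has homological dimension at most $n-1$. (For $n=0$ this says that every object is zero.) -/

import Mathlib

open CategoryTheory CategoryTheory.Limits Topology Filter

set_option linter.unusedSectionVars false

universe u v

/-! ### Cantor–Bendixson rank -/

section CantorBendixsonRank

/-- The stage `X^(α)` of the Cantor–Bendixson process on the space `X`: one starts from `X`,
removes the isolated points of `X^(α)` to get `X^(α + 1)`, and takes intersections at limits. -/
def cbStage (X : Type u) [TopologicalSpace X] (α : Ordinal.{u}) : Set X :=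
  CantorBendixson.iteratedDerivedSet (Set.univ : Set X) α

/-- The Cantor–Bendixson rank of `X`: the least ordinal at which the process is stationary. -/
noncomputable def cbRank (X : Type u) [TopologicalSpace X] : Ordinal.{u} :=
  sInf {α | ∀ β, α ≤ β → cbStage X α = cbStage X β}

/-- The perfect hull of `X`: the stage of the process at the Cantor–Bendixson rank. -/
noncomputable def perfectHull (X : Type u) [TopologicalSpace X] : Set X :=
  cbStage X (cbRank X)

/-- A space is scattered if its perfect hull is empty. -/
def IsScatteredSpace (X : Type u) [TopologicalSpace X] : Prop :=
  perfectHull X = ∅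

end CantorBendixsonRank

/-! ### Homological dimension of an abelian category -/

/-- The homological (injective) dimension of an abelian category: the supremum of the injective
dimensions of its objects. It is `⊥` if all objects are zero, and `⊤` if it is infinite. -/
noncomputable def homologicalDimension (C : Type*) [Category* C] [Abelian C] : WithBot ℕ∞ :=
  ⨆ E : C, injectiveDimension E

/-! ### Sheaf spaces with a group action -/

namespace EquivariantSheaf

/-- The total space `∐ x, S x` of a family of stalks, to be equipped with a topology. -/
@[ext]
structure Total {X : Type u} (S : X → Type u) where
  base : X
  val : S base

/-- The fibre product over `X` of the total spaces of two families of stalks. -/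
@[ext]
structure FibreProduct {X : Type u} (S T : X → Type u) where
  base : X
  fst : S base
  snd : T base

namespace FibreProduct

variable {X : Type u} {S T : X → Type u}

def toFst (p : FibreProduct S T) : Total S := ⟨p.base, p.fst⟩

def toSnd (p : FibreProduct S T) : Total T := ⟨p.base, p.snd⟩

/-- The fibre product has the subspace topology from `Total S × Total T`. -/
instance [TopologicalSpace (Total S)] [TopologicalSpace (Total T)] :
    TopologicalSpace (FibreProduct S T) :=
  TopologicalSpace.induced (fun p => (p.toFst, p.toSnd)) inferInstance

end FibreProduct

end EquivariantSheaf

open EquivariantSheaf in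
/-- A rational `G`-sheaf over the `G`-space `X`, as a sheaf space. The projection of the sheaf space
`Total stalk` to `X` is `Total.base`, so its fibre over `x` is `stalk x`. The group action on the
sheaf space covers the one on `X` by construction; `act g h` is the action of `g` as a
map from the fibre over `x` to the fibre over `y`, where `h : g • x = y`. -/
structure RationalGSheaf (G : Type v) (X : Type u) [Group G] [TopologicalSpace G]
    [TopologicalSpace X] [MulAction G X] where
  stalk : X → Type u
  [addCommGroup : ∀ x, AddCommGroup (stalk x)]
  [module : ∀ x, Module ℚ (stalk x)]
  [topology : TopologicalSpace (Total stalk)]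
  isLocalHomeomorph : IsLocalHomeomorph (Total.base : Total stalk → X)
  continuous_add : Continuous fun p : FibreProduct stalk stalk =>
    (⟨p.base, p.fst + p.snd⟩ : Total stalk)
  continuous_smul : ∀ q : ℚ, Continuous fun e : Total stalk => (⟨e.base, q • e.val⟩ : Total stalk)
  act : ∀ (g : G) {x y : X}, g • x = y → (stalk x →ₗ[ℚ] stalk y)
  act_one : ∀ {x : X} (h : (1 : G) • x = x) (e : stalk x), act 1 h e = e
  act_mul : ∀ {g k : G} {x y z : X} (hk : k • x = y) (hg : g • y = z) (hgk : (g * k) • x = z)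
    (e : stalk x), act (g * k) hgk e = act g hg (act k hk e)
  continuous_act : Continuous fun a : G × Total stalk =>
    (⟨a.1 • a.2.base, act a.1 rfl a.2.val⟩ : Total stalk)

namespace EquivariantSheaf

attribute [instance] RationalGSheaf.addCommGroup RationalGSheaf.module RationalGSheaf.topology

/-! #### Local sections of sheaf spaces -/

section Sections

variable {X : Type u} {S T : X → Type u}

/-- The map to the total space given by a choice of an element in each stalk. -/
def tot (s : ∀ y, S y) (y : X) : Total S := ⟨y, s y⟩

variable [TopologicalSpace X] [TopologicalSpace (Total S)] [TopologicalSpace (Total T)]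

theorem exists_injOn (hS : IsLocalHomeomorph (Total.base : Total S → X)) (e : Total S) :
    ∃ U ∈ 𝓝 e, Set.InjOn Total.base U := by
  obtain ⟨φ, he, hφ⟩ := hS e
  exact ⟨φ.source, φ.open_source.mem_nhds he, hφ ▸ φ.injOn⟩

theorem exists_section [∀ x, Zero (S x)] (hS : IsLocalHomeomorph (Total.base : Total S → X))
    (e : Total S) :
    ∃ s : ∀ y, S y, s e.base = e.val ∧ ContinuousAt (tot s) e.base := by
  classical
  obtain ⟨φ, he, hφ⟩ := hS e
  have key : ∀ y ∈ φ.target, (φ.symm y).base = y := fun y hy => by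
    have := φ.right_inv hy
    rwa [← hφ] at this
  have cast_eq : ∀ (e' : Total S) (y : X) (h : e'.base = y),
      (⟨y, h ▸ e'.val⟩ : Total S) = e' := by
    rintro ⟨b, w⟩ y rfl
    rfl
  let s : ∀ y, S y := fun y => if h : y ∈ φ.target then key y h ▸ (φ.symm y).val else 0
  have hs : ∀ y ∈ φ.target, tot s y = φ.symm y := fun y hy => by
    simp only [tot, s, hy, dite_true]
    exact cast_eq _ _ _
  have hbt : e.base ∈ φ.target := by
    have := φ.map_source he
    rwa [← hφ] at this
  have hse : tot s e.base = e := by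
    rw [hs _ hbt]
    have := φ.left_inv he
    rwa [← hφ] at this
  refine ⟨s, ?_, ?_⟩
  · have h2 : (⟨e.base, s e.base⟩ : Total S) = ⟨e.base, e.val⟩ := hse
    rw [Total.mk.injEq] at h2
    exact eq_of_heq h2.2
  · refine (φ.symm.continuousAt hbt).congr ?_
    filter_upwards [φ.open_target.mem_nhds hbt] with y hy
    exact (hs y hy).symm

theorem isLocalHomeomorph_of_sections (hc : Continuous (Total.base : Total S → X))
    (hi : ∀ e : Total S, ∃ U ∈ 𝓝 e, Set.InjOn Total.base U)
    (hs : ∀ e : Total S, ∃ s : ∀ y, S y, s e.base = e.val ∧ ContinuousAt (tot s) e.base) :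
    IsLocalHomeomorph (Total.base : Total S → X) := by
  have ho : IsOpenMap (Total.base : Total S → X) := by
    refine IsOpenMap.of_nhds_le fun e W hW => ?_
    obtain ⟨s, hse, hsc⟩ := hs e
    have hte : tot s e.base = e := by rw [tot, hse]
    have : ∀ᶠ y in 𝓝 e.base, tot s y ∈ Total.base ⁻¹' W :=
      hsc.eventually_mem (by rw [hte]; exact hW)
    exact this
  rw [isLocalHomeomorph_iff_isOpenEmbedding_restrict]
  intro e
  obtain ⟨U, hU, hinj⟩ := hi e
  refine ⟨interior U, interior_mem_nhds.2 hU, ?_⟩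
  refine .of_continuous_injective_isOpenMap (hc.comp continuous_subtype_val)
    (hinj.mono interior_subset).injective (ho.domRestrict isOpen_interior)

theorem nhds_eq_map (hS : IsLocalHomeomorph (Total.base : Total S → X)) (s : ∀ y, S y) (x : X)
    (hs : ContinuousAt (tot s) x) : 𝓝 (tot s x) = map (tot s) (𝓝 x) := by
  refine le_antisymm ?_ hs
  obtain ⟨U, hU, hinj⟩ := exists_injOn hS (tot s x)
  intro W hW
  have hb : Tendsto Total.base (𝓝 (tot s x)) (𝓝 x) := hS.continuous.continuousAt
  filter_upwards [hU, hb (hs.eventually_mem hU), hb hW] with e heU he heW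
  have : tot s e.base = e := hinj he heU rfl
  rw [← this]
  exact heW

theorem continuousAt_iff_section {Z : Type*} [TopologicalSpace Z]
    (hS : IsLocalHomeomorph (Total.base : Total S → X)) (f : Total S → Z) (s : ∀ y, S y) (x : X)
    (hs : ContinuousAt (tot s) x) :
    ContinuousAt f (tot s x) ↔ ContinuousAt (fun y => f (tot s y)) x := by
  rw [ContinuousAt, nhds_eq_map hS s x hs, tendsto_map'_iff]
  rfl

theorem eventually_eq (hS : IsLocalHomeomorph (Total.base : Total S → X)) (s t : ∀ y, S y) (x : X)
    (hs : ContinuousAt (tot s) x) (ht : ContinuousAt (tot t) x) (h : s x = t x) :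
    ∀ᶠ y in 𝓝 x, s y = t y := by
  obtain ⟨U, hU, hinj⟩ := exists_injOn hS (tot s x)
  have hU' : U ∈ 𝓝 (tot t x) := by rwa [tot, ← h]
  filter_upwards [hs.eventually_mem hU, ht.eventually_mem hU'] with y h1 h2
  have h3 : (⟨y, s y⟩ : Total S) = ⟨y, t y⟩ := hinj h1 h2 rfl
  rw [Total.mk.injEq] at h3
  exact eq_of_heq h3.2

theorem continuous_of_sections {Z : Type*} [TopologicalSpace Z] [∀ x, Zero (S x)]
    (hS : IsLocalHomeomorph (Total.base : Total S → X)) (f : Total S → Z)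
    (h : ∀ (s : ∀ y, S y) (x : X), ContinuousAt (tot s) x →
      ContinuousAt (fun y => f (tot s y)) x) : Continuous f := by
  rw [continuous_iff_continuousAt]
  intro e
  obtain ⟨s, hse, hs⟩ := exists_section hS e
  have hte : tot s e.base = e := by rw [tot, hse]
  rw [← hte]
  exact (continuousAt_iff_section hS f s _ hs).2 (h s _ hs)

/-! #### Fibre products -/

namespace FibreProduct

theorem continuous_toFst : Continuous (toFst : FibreProduct S T → Total S) :=
  continuous_fst.comp
    (continuous_induced_dom (f := fun p : FibreProduct S T => (p.toFst, p.toSnd)))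

theorem continuous_toSnd : Continuous (toSnd : FibreProduct S T → Total T) :=
  continuous_snd.comp
    (continuous_induced_dom (f := fun p : FibreProduct S T => (p.toFst, p.toSnd)))

theorem continuous_mk {Z : Type*} [TopologicalSpace Z] {f : Z → FibreProduct S T}
    (h1 : Continuous fun z => (f z).toFst) (h2 : Continuous fun z => (f z).toSnd) :
    Continuous f :=
  continuous_induced_rng.2 (h1.prodMk h2)

theorem continuousAt_mk {Z : Type*} [TopologicalSpace Z] {f : Z → FibreProduct S T} {z : Z}
    (h1 : ContinuousAt (fun z => (f z).toFst) z) (h2 : ContinuousAt (fun z => (f z).toSnd) z) :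
    ContinuousAt f z :=
  (Topology.IsInducing.induced (fun p : FibreProduct S T => (p.toFst, p.toSnd))).continuousAt_iff.2
    (h1.prodMk h2)

theorem continuous_of_sections {Z : Type*} [TopologicalSpace Z] [∀ x, Zero (S x)] [∀ x, Zero (T x)]
    (hS : IsLocalHomeomorph (Total.base : Total S → X))
    (hT : IsLocalHomeomorph (Total.base : Total T → X)) (f : FibreProduct S T → Z)
    (h : ∀ (s : ∀ y, S y) (t : ∀ y, T y) (x : X), ContinuousAt (tot s) x → ContinuousAt (tot t) x →
      ContinuousAt (fun y => f ⟨y, s y, t y⟩) x) : Continuous f := by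
  rw [continuous_iff_continuousAt]
  intro p
  obtain ⟨s, hse, hs⟩ := exists_section hS p.toFst
  obtain ⟨t, hte, ht⟩ := exists_section hT p.toSnd
  change s p.base = p.fst at hse
  change t p.base = p.snd at hte
  change ContinuousAt (tot s) p.base at hs
  change ContinuousAt (tot t) p.base at ht
  have hp : (⟨p.base, s p.base, t p.base⟩ : FibreProduct S T) = p := by rw [hse, hte]
  have hs' : tot s p.base = p.toFst := by rw [tot, hse]; rfl
  have ht' : tot t p.base = p.toSnd := by rw [tot, hte]; rfl
  obtain ⟨U, hU, hUi⟩ := exists_injOn hS p.toFst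
  obtain ⟨V, hV, hVi⟩ := exists_injOn hT p.toSnd
  have hb : Tendsto FibreProduct.base (𝓝 p) (𝓝 p.base) :=
    (hS.continuous.comp (continuous_toFst (S := S) (T := T))).continuousAt
  intro W hW
  rw [mem_map]
  have hW' : W ∈ 𝓝 (f ⟨p.base, s p.base, t p.base⟩) := by rwa [hp]
  filter_upwards [(continuous_toFst.continuousAt (x := p)).eventually_mem hU,
    (continuous_toSnd.continuousAt (x := p)).eventually_mem hV,
    hb (hs.eventually_mem (hs' ▸ hU)), hb (ht.eventually_mem (ht' ▸ hV)),
    hb ((h s t p.base hs ht) hW')] with q h1 h2 h3 h4 h5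
  have e1 : tot s q.base = q.toFst := hUi h3 h1 rfl
  have e2 : tot t q.base = q.toSnd := hVi h4 h2 rfl
  have e3 : (⟨q.base, s q.base, t q.base⟩ : FibreProduct S T) = q := by
    obtain ⟨b, a, c⟩ := q
    simp only [tot, toFst, toSnd, Total.mk.injEq, heq_eq_eq, true_and] at e1 e2
    simp only [e1, e2]
  change f ⟨q.base, s q.base, t q.base⟩ ∈ W at h5
  rw [e3] at h5
  exact h5

end FibreProduct

end Sections

/-! #### Morphisms and the category of rational `G`-sheaves -/

variable {G : Type v} {X : Type u} [Group G] [TopologicalSpace G] [TopologicalSpace X]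
  [MulAction G X]

/-- A map of rational `G`-sheaves: a continuous `G`-equivariant map of sheaf spaces over `X` which
is `ℚ`-linear on each stalk. -/
@[ext]
structure Hom (E F : RationalGSheaf G X) where
  app : ∀ x, E.stalk x →ₗ[ℚ] F.stalk x
  equivariant : ∀ (g : G) {x y : X} (h : g • x = y) (e : E.stalk x),
    app y (E.act g h e) = F.act g h (app x e)
  continuous : Continuous fun e : Total E.stalk => (⟨e.base, app e.base e.val⟩ : Total F.stalk)

instance : Category.{u} (RationalGSheaf G X) where
  Hom := Hom
  id E := ⟨fun _ => LinearMap.id, fun _ _ _ _ _ => rfl, continuous_id⟩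
  comp f k := ⟨fun x => (k.app x).comp (f.app x),
    fun g x y h e => by simp [f.equivariant, k.equivariant], k.continuous.comp f.continuous⟩

variable {E F : RationalGSheaf G X}

@[ext]
theorem hom_ext {f k : E ⟶ F} (h : ∀ x (e : E.stalk x), f.app x e = k.app x e) : f = k :=
  Hom.ext (funext fun x => LinearMap.ext (h x))

@[simp]
theorem id_app (E : RationalGSheaf G X) (x : X) (e : E.stalk x) : Hom.app (𝟙 E) x e = e := rfl

@[simp]
theorem comp_app {E F K : RationalGSheaf G X} (f : E ⟶ F) (k : F ⟶ K) (x : X) (e : E.stalk x) :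
    (f ≫ k).app x e = k.app x (f.app x e) := rfl

/-- The map of sheaf spaces underlying a map of rational `G`-sheaves. -/
def totalMap (f : E ⟶ F) (e : Total E.stalk) : Total F.stalk := ⟨e.base, f.app e.base e.val⟩

theorem continuous_totalMap (f : E ⟶ F) : Continuous (totalMap f) := f.continuous

theorem continuous_add_comp {Z : Type*} [TopologicalSpace Z] (f : Z → FibreProduct E.stalk E.stalk)
    (h1 : Continuous fun z => (f z).toFst) (h2 : Continuous fun z => (f z).toSnd) :
    Continuous fun z => (⟨(f z).base, (f z).fst + (f z).snd⟩ : Total E.stalk) :=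
  E.continuous_add.comp (FibreProduct.continuous_mk h1 h2)

theorem section_add {s t : ∀ y, E.stalk y} {x : X} (hs : ContinuousAt (tot s) x)
    (ht : ContinuousAt (tot t) x) : ContinuousAt (tot fun y => s y + t y) x :=
  ContinuousAt.comp (f := fun y => (⟨y, s y, t y⟩ : FibreProduct E.stalk E.stalk))
    (g := fun p => (⟨p.base, p.fst + p.snd⟩ : Total E.stalk)) E.continuous_add.continuousAt
    (FibreProduct.continuousAt_mk hs ht)

theorem section_smul (q : ℚ) {s : ∀ y, E.stalk y} {x : X} (hs : ContinuousAt (tot s) x) :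
    ContinuousAt (tot fun y => q • s y) x :=
  ((E.continuous_smul q).continuousAt (x := tot s x)).comp (f := tot s) hs

theorem section_neg {s : ∀ y, E.stalk y} {x : X} (hs : ContinuousAt (tot s) x) :
    ContinuousAt (tot fun y => - s y) x := by
  simpa using section_smul (-1) hs

theorem section_zero (x : X) : ContinuousAt (tot fun y => (0 : E.stalk y)) x := by
  obtain ⟨s, hs0, hs⟩ := exists_section E.isLocalHomeomorph ⟨x, 0⟩
  change s x = 0 at hs0
  change ContinuousAt (tot s) x at hs
  refine (section_add hs (section_neg hs)).congr ?_
  filter_upwards with y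
  simp [tot]

theorem section_map (f : E ⟶ F) {s : ∀ y, E.stalk y} {x : X} (hs : ContinuousAt (tot s) x) :
    ContinuousAt (tot fun y => f.app y (s y)) x :=
  ((continuous_totalMap f).continuousAt (x := tot s x)).comp (f := tot s) hs

/-- A stalkwise linear equivariant family which preserves local sections is a map of `G`-sheaves. -/
def homOfSections (app : ∀ x, E.stalk x →ₗ[ℚ] F.stalk x)
    (equivariant : ∀ (g : G) {x y : X} (h : g • x = y) (e : E.stalk x),
      app y (E.act g h e) = F.act g h (app x e))
    (hs : ∀ (s : ∀ y, E.stalk y) (x : X), ContinuousAt (tot s) x →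
      ContinuousAt (tot fun y => app y (s y)) x) : E ⟶ F where
  app := app
  equivariant := equivariant
  continuous := continuous_of_sections E.isLocalHomeomorph _ hs

/-! #### The preadditive structure -/

instance : Zero (E ⟶ F) :=
  ⟨homOfSections (fun _ => 0) (fun _ _ _ _ _ => by simp) fun _ _ _ => section_zero _⟩

instance : Add (E ⟶ F) :=
  ⟨fun f k => homOfSections (fun x => f.app x + k.app x)
    (fun _ _ _ _ _ => by simp [f.equivariant, k.equivariant])
    fun _ _ hs => section_add (section_map f hs) (section_map k hs)⟩

instance : Neg (E ⟶ F) :=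
  ⟨fun f => homOfSections (fun x => - f.app x)
    (fun _ _ _ _ _ => by simp [f.equivariant])
    fun _ _ hs => section_neg (section_map f hs)⟩

@[simp]
theorem zero_app (x : X) (e : E.stalk x) : Hom.app (0 : E ⟶ F) x e = 0 := rfl

@[simp]
theorem add_app (f k : E ⟶ F) (x : X) (e : E.stalk x) :
    (f + k).app x e = f.app x e + k.app x e := rfl

@[simp]
theorem neg_app (f : E ⟶ F) (x : X) (e : E.stalk x) : (-f).app x e = - f.app x e := rfl

instance : AddCommGroup (E ⟶ F) where
  add_assoc _ _ _ := by ext; simp [add_assoc]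
  zero_add _ := by ext; simp
  add_zero _ := by ext; simp
  add_comm _ _ := by ext; simp [add_comm]
  neg_add_cancel _ := by ext; simp
  nsmul := nsmulRec
  zsmul := zsmulRec

instance : Preadditive (RationalGSheaf G X) where
  add_comp _ _ _ _ _ _ := by ext; simp
  comp_add _ _ _ _ _ _ := by ext; simp

@[simp]
theorem sub_app (f k : E ⟶ F) (x : X) (e : E.stalk x) :
    (f - k).app x e = f.app x e - k.app x e := by
  simp [sub_eq_add_neg]

/-! #### Kernels -/

section Kernel

variable (f : E ⟶ F)

def kerIncl (e : Total fun x => LinearMap.ker (f.app x)) : Total E.stalk := ⟨e.base, e.val.1⟩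

instance kerTopology : TopologicalSpace (Total fun x => LinearMap.ker (f.app x)) :=
  TopologicalSpace.induced (kerIncl f) inferInstance

theorem kerIncl_inducing : Topology.IsInducing (kerIncl f) := ⟨rfl⟩

theorem ker_isLocalHomeomorph : IsLocalHomeomorph
    (Total.base : (Total fun x => LinearMap.ker (f.app x)) → X) := by
  classical
  refine isLocalHomeomorph_of_sections
    (E.isLocalHomeomorph.continuous.comp (kerIncl_inducing f).continuous) ?_ ?_
  · intro e
    obtain ⟨U, hU, hi⟩ := exists_injOn E.isLocalHomeomorph (kerIncl f e)
    refine ⟨_, (kerIncl_inducing f).continuous.continuousAt hU, ?_⟩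
    rintro ⟨a, v, hv⟩ ha ⟨b, w, hw⟩ hb hab
    have := hi ha hb hab
    simp only [kerIncl] at this
    cases this
    rfl
  · rintro ⟨x, w, hw⟩
    obtain ⟨s, hsx, hs⟩ := exists_section E.isLocalHomeomorph ⟨x, w⟩
    change s x = w at hsx
    change ContinuousAt (tot s) x at hs
    subst hsx
    refine ⟨fun y => if h : f.app y (s y) = 0 then ⟨s y, h⟩ else 0, ?_, ?_⟩
    · exact dif_pos (LinearMap.mem_ker.1 hw)
    · rw [(kerIncl_inducing f).continuousAt_iff]
      refine hs.congr ?_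
      filter_upwards [eventually_eq F.isLocalHomeomorph _ _ x (section_map f hs) (section_zero x)
        (LinearMap.mem_ker.1 hw)] with y hy
      simp [kerIncl, tot, hy]

def ker : RationalGSheaf G X where
  stalk x := LinearMap.ker (f.app x)
  topology := kerTopology f
  isLocalHomeomorph := ker_isLocalHomeomorph f
  continuous_add := (kerIncl_inducing f).continuous_iff.2 <|
    continuous_add_comp (E := E)
        (fun p : FibreProduct (fun x => LinearMap.ker (f.app x))
          (fun x => LinearMap.ker (f.app x)) => ⟨p.base, p.fst.1, p.snd.1⟩)
        ((kerIncl_inducing f).continuous.comp FibreProduct.continuous_toFst)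
        ((kerIncl_inducing f).continuous.comp FibreProduct.continuous_toSnd)
  continuous_smul q := (kerIncl_inducing f).continuous_iff.2 <|
    (E.continuous_smul q).comp (kerIncl_inducing f).continuous
  act g x y h := (E.act g h).restrict fun e he => by
    rw [LinearMap.mem_ker] at he ⊢
    rw [f.equivariant, he, map_zero]
  act_one h e := Subtype.ext (E.act_one h e.1)
  act_mul hk hg hgk e := Subtype.ext (E.act_mul hk hg hgk e.1)
  continuous_act := (kerIncl_inducing f).continuous_iff.2 <|
    E.continuous_act.comp (continuous_id.prodMap (kerIncl_inducing f).continuous)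

def kerι : ker f ⟶ E where
  app x := (LinearMap.ker (f.app x)).subtype
  equivariant _ _ _ _ _ := rfl
  continuous := (kerIncl_inducing f).continuous

def kerLift {K : RationalGSheaf G X} (k : K ⟶ E) (hk : k ≫ f = 0) : K ⟶ ker f where
  app x := (k.app x).codRestrict _ fun e => by
    rw [LinearMap.mem_ker, ← comp_app, hk, zero_app]
  equivariant g x y h e := Subtype.ext (k.equivariant g h e)
  continuous := (kerIncl_inducing f).continuous_iff.2 k.continuous

theorem kerι_comp : kerι f ≫ f = 0 := by
  ext x e
  exact e.2

def kerIsLimit : IsLimit (KernelFork.ofι (kerι f) (kerι_comp f)) :=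
  KernelFork.IsLimit.ofι _ _ (fun k hk => kerLift f k hk) (fun _ _ => rfl) fun k hk m hm => by
    ext x e
    refine Subtype.ext ?_
    change (m ≫ kerι f).app x e = k.app x e
    rw [hm]

instance : HasKernels (RationalGSheaf G X) where
  has_limit f := ⟨⟨_, kerIsLimit f⟩⟩

end Kernel

/-! #### Cokernels -/

section Cokernel

variable (f : E ⟶ F)

def cokerProj (e : Total F.stalk) : Total fun x => F.stalk x ⧸ LinearMap.range (f.app x) :=
  ⟨e.base, Submodule.Quotient.mk e.val⟩

instance cokerTopology : TopologicalSpace (Total fun x => F.stalk x ⧸ LinearMap.range (f.app x)) :=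
  TopologicalSpace.coinduced (cokerProj f) inferInstance

theorem cokerProj_surjective : Function.Surjective (cokerProj f) := by
  rintro ⟨x, e⟩
  obtain ⟨e, rfl⟩ := Submodule.Quotient.mk_surjective _ e
  exact ⟨⟨x, e⟩, rfl⟩

theorem cokerProj_isQuotientMap : Topology.IsQuotientMap (cokerProj f) :=
  ⟨⟨rfl⟩, cokerProj_surjective f⟩

theorem cokerProj_isOpenMap : IsOpenMap (cokerProj f) := by
  intro U hU
  rw [← (cokerProj_isQuotientMap f).isOpen_preimage, isOpen_iff_mem_nhds]
  rintro ⟨x, w⟩ ⟨⟨x', w'⟩, hw'U, h⟩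
  simp only [cokerProj, Total.mk.injEq] at h
  obtain ⟨rfl, h⟩ := h
  rw [heq_eq_eq, Submodule.Quotient.eq] at h
  obtain ⟨k, hk⟩ := h
  obtain ⟨t, htx, ht⟩ := exists_section F.isLocalHomeomorph ⟨x', w⟩
  obtain ⟨r, hrx, hr⟩ := exists_section E.isLocalHomeomorph ⟨x', k⟩
  change t x' = w at htx
  change r x' = k at hrx
  change ContinuousAt (tot t) x' at ht
  change ContinuousAt (tot r) x' at hr
  subst htx hrx
  have hu := section_add ht (section_map f hr)
  have hux : (tot fun y => t y + f.app y (r y)) x' = ⟨x', w'⟩ := by simp [tot, hk]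
  change _ ∈ 𝓝 (tot t x')
  rw [nhds_eq_map F.isLocalHomeomorph t x' ht, mem_map]
  have hU' : U ∈ 𝓝 ((tot fun y => t y + f.app y (r y)) x') := by
    rw [hux]
    exact hU.mem_nhds hw'U
  filter_upwards [hu.eventually_mem hU'] with y hy
  refine ⟨_, hy, ?_⟩
  have hq : (Submodule.Quotient.mk (t y + f.app y (r y)) :
      F.stalk y ⧸ LinearMap.range (f.app y)) = Submodule.Quotient.mk (t y) := by
    rw [Submodule.Quotient.eq]
    exact ⟨r y, by simp⟩
  exact congrArg (Total.mk y) hq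

theorem cokerProj_isOpenQuotientMap : IsOpenQuotientMap (cokerProj f) :=
  ⟨cokerProj_surjective f, (cokerProj_isQuotientMap f).continuous, cokerProj_isOpenMap f⟩

theorem coker_isLocalHomeomorph : IsLocalHomeomorph
    (Total.base : (Total fun x => F.stalk x ⧸ LinearMap.range (f.app x)) → X) := by
  refine isLocalHomeomorph_of_sections
    ((cokerProj_isQuotientMap f).continuous_iff.2 F.isLocalHomeomorph.continuous) ?_ ?_
  · intro e
    obtain ⟨e, rfl⟩ := cokerProj_surjective f e
    obtain ⟨U, hU, hi⟩ := exists_injOn F.isLocalHomeomorph e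
    refine ⟨_, (cokerProj_isOpenMap f).image_mem_nhds hU, ?_⟩
    rintro _ ⟨a, ha, rfl⟩ _ ⟨b, hb, rfl⟩ hab
    rw [hi ha hb hab]
  · intro e
    obtain ⟨e, rfl⟩ := cokerProj_surjective f e
    obtain ⟨s, hsx, hs⟩ := exists_section F.isLocalHomeomorph e
    refine ⟨fun y => Submodule.Quotient.mk (s y), ?_, ?_⟩
    · exact congrArg Submodule.Quotient.mk hsx
    · exact ((cokerProj_isQuotientMap f).continuous.continuousAt (x := tot s e.base)).comp
        (f := tot s) hs

theorem exists_section_coker (s : ∀ y, F.stalk y ⧸ LinearMap.range (f.app y)) (x : X)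
    (hs : ContinuousAt (tot s) x) : ∃ t : ∀ y, F.stalk y, ContinuousAt (tot t) x ∧
      ∀ᶠ y in 𝓝 x, s y = Submodule.Quotient.mk (t y) := by
  obtain ⟨w, hw⟩ := Submodule.Quotient.mk_surjective _ (s x)
  obtain ⟨t, htx, ht⟩ := exists_section F.isLocalHomeomorph ⟨x, w⟩
  change t x = w at htx
  change ContinuousAt (tot t) x at ht
  refine ⟨t, ht, eventually_eq (coker_isLocalHomeomorph f) s _ x hs ?_ (by rw [htx, hw])⟩
  exact ((cokerProj_isQuotientMap f).continuous.continuousAt (x := tot t x)).comp (f := tot t) ht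

def coker : RationalGSheaf G X where
  stalk x := F.stalk x ⧸ LinearMap.range (f.app x)
  topology := cokerTopology f
  isLocalHomeomorph := coker_isLocalHomeomorph f
  continuous_add := by
    refine FibreProduct.continuous_of_sections (coker_isLocalHomeomorph f)
      (coker_isLocalHomeomorph f) _ fun s t x hs ht => ?_
    obtain ⟨s', hs', hss⟩ := exists_section_coker f s x hs
    obtain ⟨t', ht', htt⟩ := exists_section_coker f t x ht
    refine (((cokerProj_isQuotientMap f).continuous.continuousAt).comp
      (section_add hs' ht')).congr ?_
    filter_upwards [hss, htt] with y h1 h2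
    simp only [h1, h2]
    rfl
  continuous_smul q := (cokerProj_isQuotientMap f).continuous_iff.2 <|
    (cokerProj_isQuotientMap f).continuous.comp (F.continuous_smul q)
  act g x y h := Submodule.mapQ _ _ (F.act g h) <| by
    rintro _ ⟨e, rfl⟩
    exact ⟨E.act g h e, f.equivariant g h e⟩
  act_one h e := by
    obtain ⟨e, rfl⟩ := Submodule.Quotient.mk_surjective _ e
    exact congrArg Submodule.Quotient.mk (F.act_one h e)
  act_mul hk hg hgk e := by
    obtain ⟨e, rfl⟩ := Submodule.Quotient.mk_surjective _ e
    exact congrArg Submodule.Quotient.mk (F.act_mul hk hg hgk e)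
  continuous_act :=
    (IsOpenQuotientMap.id.prodMap (cokerProj_isOpenQuotientMap f)).isQuotientMap.continuous_iff.2 <|
      (cokerProj_isQuotientMap f).continuous.comp F.continuous_act

def cokerπ : F ⟶ coker f where
  app x := (LinearMap.range (f.app x)).mkQ
  equivariant _ _ _ _ _ := rfl
  continuous := (cokerProj_isQuotientMap f).continuous

def cokerDesc {K : RationalGSheaf G X} (k : F ⟶ K) (hk : f ≫ k = 0) : coker f ⟶ K where
  app x := (LinearMap.range (f.app x)).liftQ (k.app x) <| by
    rintro _ ⟨e, rfl⟩
    rw [LinearMap.mem_ker, ← comp_app, hk, zero_app]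
  equivariant g x y h e := by
    obtain ⟨e, rfl⟩ := Submodule.Quotient.mk_surjective _ e
    exact k.equivariant g h e
  continuous := (cokerProj_isQuotientMap f).continuous_iff.2 k.continuous

theorem comp_cokerπ : f ≫ cokerπ f = 0 := by
  ext x e
  exact (Submodule.Quotient.mk_eq_zero _).2 ⟨e, rfl⟩

def cokerIsColimit : IsColimit (CokernelCofork.ofπ (cokerπ f) (comp_cokerπ f)) :=
  CokernelCofork.IsColimit.ofπ _ _ (fun k hk => cokerDesc f k hk) (fun _ _ => rfl)
    fun k hk m hm => by
      ext x e
      obtain ⟨e, rfl⟩ := Submodule.Quotient.mk_surjective _ e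
      change (cokerπ f ≫ m).app x e = k.app x e
      rw [hm]

instance : HasCokernels (RationalGSheaf G X) where
  has_colimit f := ⟨⟨_, cokerIsColimit f⟩⟩

end Cokernel

/-! #### Finite products -/

section Products

variable (E F)

def prodTotal (e : Total fun x => E.stalk x × F.stalk x) : FibreProduct E.stalk F.stalk :=
  ⟨e.base, e.val.1, e.val.2⟩

instance prodTopology : TopologicalSpace (Total fun x => E.stalk x × F.stalk x) :=
  TopologicalSpace.induced (prodTotal E F) inferInstance

theorem prodTotal_inducing : Topology.IsInducing (prodTotal E F) := ⟨rfl⟩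

theorem continuous_prod_fst : Continuous fun e : Total fun x => E.stalk x × F.stalk x =>
    (⟨e.base, e.val.1⟩ : Total E.stalk) :=
  FibreProduct.continuous_toFst.comp (prodTotal_inducing E F).continuous

theorem continuous_prod_snd : Continuous fun e : Total fun x => E.stalk x × F.stalk x =>
    (⟨e.base, e.val.2⟩ : Total F.stalk) :=
  FibreProduct.continuous_toSnd.comp (prodTotal_inducing E F).continuous

def prod : RationalGSheaf G X where
  stalk x := E.stalk x × F.stalk x
  topology := prodTopology E F
  isLocalHomeomorph := by
    refine isLocalHomeomorph_of_sections
      (E.isLocalHomeomorph.continuous.comp (continuous_prod_fst E F)) ?_ ?_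
    · intro e
      obtain ⟨U, hU, hUi⟩ := exists_injOn E.isLocalHomeomorph ⟨e.base, e.val.1⟩
      obtain ⟨V, hV, hVi⟩ := exists_injOn F.isLocalHomeomorph ⟨e.base, e.val.2⟩
      refine ⟨_, Filter.inter_mem ((continuous_prod_fst E F).continuousAt hU)
        ((continuous_prod_snd E F).continuousAt hV), ?_⟩
      rintro ⟨a, v, w⟩ ⟨ha1, ha2⟩ ⟨b, v', w'⟩ ⟨hb1, hb2⟩ hab
      have h1 := hUi ha1 hb1 hab
      have h2 := hVi ha2 hb2 hab
      dsimp only at h1 h2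
      cases h1
      cases h2
      rfl
    · rintro ⟨x, v, w⟩
      obtain ⟨s, hsx, hs⟩ := exists_section E.isLocalHomeomorph ⟨x, v⟩
      obtain ⟨t, htx, ht⟩ := exists_section F.isLocalHomeomorph ⟨x, w⟩
      exact ⟨fun y => (s y, t y), Prod.ext hsx htx,
        (prodTotal_inducing E F).continuousAt_iff.2 (FibreProduct.continuousAt_mk hs ht)⟩
  continuous_add := (prodTotal_inducing E F).continuous_iff.2 <|
    FibreProduct.continuous_mk
      (continuous_add_comp (E := E)
          (fun p : FibreProduct (fun x => E.stalk x × F.stalk x)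
            (fun x => E.stalk x × F.stalk x) => ⟨p.base, p.fst.1, p.snd.1⟩)
          ((continuous_prod_fst E F).comp FibreProduct.continuous_toFst)
          ((continuous_prod_fst E F).comp FibreProduct.continuous_toSnd))
      (continuous_add_comp (E := F)
          (fun p : FibreProduct (fun x => E.stalk x × F.stalk x)
            (fun x => E.stalk x × F.stalk x) => ⟨p.base, p.fst.2, p.snd.2⟩)
          ((continuous_prod_snd E F).comp FibreProduct.continuous_toFst)
          ((continuous_prod_snd E F).comp FibreProduct.continuous_toSnd))
  continuous_smul q := (prodTotal_inducing E F).continuous_iff.2 <|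
    FibreProduct.continuous_mk
      ((E.continuous_smul q).comp (continuous_prod_fst E F))
      ((F.continuous_smul q).comp (continuous_prod_snd E F))
  act g x y h := (E.act g h).prodMap (F.act g h)
  act_one h e := Prod.ext (E.act_one h e.1) (F.act_one h e.2)
  act_mul hk hg hgk e := Prod.ext (E.act_mul hk hg hgk e.1) (F.act_mul hk hg hgk e.2)
  continuous_act := (prodTotal_inducing E F).continuous_iff.2 <|
    FibreProduct.continuous_mk
      (E.continuous_act.comp (continuous_id.prodMap (continuous_prod_fst E F)))
      (F.continuous_act.comp (continuous_id.prodMap (continuous_prod_snd E F)))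

def prodFst : prod E F ⟶ E where
  app _ := LinearMap.fst ℚ _ _
  equivariant _ _ _ _ _ := rfl
  continuous := continuous_prod_fst E F

def prodSnd : prod E F ⟶ F where
  app _ := LinearMap.snd ℚ _ _
  equivariant _ _ _ _ _ := rfl
  continuous := continuous_prod_snd E F

variable {E F} in
def prodLift {K : RationalGSheaf G X} (f : K ⟶ E) (k : K ⟶ F) : K ⟶ prod E F where
  app x := (f.app x).prod (k.app x)
  equivariant g _ _ h e := Prod.ext (f.equivariant g h e) (k.equivariant g h e)
  continuous := (prodTotal_inducing E F).continuous_iff.2 <|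
    FibreProduct.continuous_mk f.continuous k.continuous

def prodIsLimit : IsLimit (BinaryFan.mk (prodFst E F) (prodSnd E F)) :=
  BinaryFan.IsLimit.mk _ (fun f k => prodLift f k) (fun _ _ => rfl) (fun _ _ => rfl)
    fun f k m h1 h2 => by
      ext x e
      refine Prod.ext ?_ ?_
      · change (m ≫ prodFst E F).app x e = f.app x e
        rw [← h1]
        rfl
      · change (m ≫ prodSnd E F).app x e = k.app x e
        rw [← h2]
        rfl

instance : HasBinaryProducts (RationalGSheaf G X) :=
  have : ∀ E F : RationalGSheaf G X, HasLimit (pair E F) := fun E F => ⟨⟨_, prodIsLimit E F⟩⟩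
  hasBinaryProducts_of_hasLimit_pair _

end Products

instance zeroTopology : TopologicalSpace (Total fun _ : X => PUnit.{u + 1}) :=
  TopologicalSpace.induced Total.base inferInstance

theorem zero_base_inducing :
    Topology.IsInducing (Total.base : (Total fun _ : X => PUnit.{u + 1}) → X) := ⟨rfl⟩

variable (G X) in
def zeroSheaf [ContinuousSMul G X] : RationalGSheaf G X where
  stalk _ := PUnit
  topology := zeroTopology
  isLocalHomeomorph := isLocalHomeomorph_of_sections zero_base_inducing.continuous
    (fun _ => ⟨Set.univ, Filter.univ_mem, fun _ _ _ _ h => Total.ext h (by subsingleton)⟩)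
    fun e => ⟨fun _ => PUnit.unit, rfl, zero_base_inducing.continuousAt_iff.2 continuousAt_id⟩
  continuous_add := zero_base_inducing.continuous_iff.2 <|
    zero_base_inducing.continuous.comp FibreProduct.continuous_toFst
  continuous_smul _ := zero_base_inducing.continuous_iff.2 zero_base_inducing.continuous
  act _ _ _ _ := 0
  act_one _ _ := rfl
  act_mul _ _ _ _ := rfl
  continuous_act := zero_base_inducing.continuous_iff.2 <|
    continuous_smul.comp (continuous_id.prodMap zero_base_inducing.continuous)

instance [ContinuousSMul G X] : HasZeroObject (RationalGSheaf G X) where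
  zero := by
    refine ⟨zeroSheaf G X, ?_⟩
    rw [IsZero.iff_id_eq_zero]
    ext x e
    rfl

/-! #### Monomorphisms and epimorphisms -/

theorem injective_of_mono (f : E ⟶ F) [Mono f] (x : X) : Function.Injective (f.app x) := by
  rw [injective_iff_map_eq_zero]
  intro e he
  have h : kerι f = 0 := by
    rw [← cancel_mono f, kerι_comp, zero_comp]
  have := congrArg (fun k : ker f ⟶ E => Hom.app k x (⟨e, he⟩ : LinearMap.ker (f.app x))) h
  exact this

theorem surjective_of_epi (f : E ⟶ F) [Epi f] (x : X) : Function.Surjective (f.app x) := by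
  intro e
  have h : cokerπ f = 0 := by
    rw [← cancel_epi f, comp_cokerπ, comp_zero]
  have : (cokerπ f).app x e = 0 := congrArg (fun k => Hom.app k x e) h
  exact (Submodule.Quotient.mk_eq_zero _).1 this

/-- A map which is injective on stalks is the kernel of its cokernel. -/
theorem nonempty_normalMono (f : E ⟶ F) [Mono f] : Nonempty (NormalMono f) := ⟨{
  Z := coker f
  g := cokerπ f
  w := comp_cokerπ f
  isLimit := by
    have hmem : ∀ {K : RationalGSheaf G X} (k : K ⟶ F), k ≫ cokerπ f = 0 → ∀ x e,
        k.app x e ∈ LinearMap.range (f.app x) := fun k hk x e =>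
      (Submodule.Quotient.mk_eq_zero _).1 (congrArg (fun m => Hom.app m x e) hk)
    let lift {K : RationalGSheaf G X} (k : K ⟶ F) (hk : k ≫ cokerπ f = 0) (x : X) :
        K.stalk x →ₗ[ℚ] E.stalk x :=
      (LinearEquiv.ofInjective (f.app x) (injective_of_mono f x)).symm.toLinearMap.comp
        ((k.app x).codRestrict _ (hmem k hk x))
    have hlift : ∀ {K : RationalGSheaf G X} (k : K ⟶ F) (hk : k ≫ cokerπ f = 0) (x : X)
        (e : K.stalk x), f.app x (lift k hk x e) = k.app x e := fun k hk x e =>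
      congrArg Subtype.val
        ((LinearEquiv.ofInjective (f.app x) (injective_of_mono f x)).apply_symm_apply
          ⟨k.app x e, hmem k hk x e⟩)
    refine KernelFork.IsLimit.ofι _ _ (fun {K} k hk => homOfSections (lift k hk) ?_ ?_) ?_ ?_
    · intro g x y h e
      apply injective_of_mono f y
      rw [hlift k hk, f.equivariant, hlift k hk, k.equivariant]
    · intro s x hs
      obtain ⟨t, htx, ht⟩ := exists_section E.isLocalHomeomorph ⟨x, lift k hk x (s x)⟩
      change t x = _ at htx
      change ContinuousAt (tot t) x at ht
      refine ht.congr ?_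
      filter_upwards [eventually_eq F.isLocalHomeomorph _ _ x (section_map f ht) (section_map k hs)
        (by rw [htx, hlift k hk])] with y hy
      simp only [tot, Total.mk.injEq, heq_eq_eq, true_and]
      apply injective_of_mono f y
      rw [hy, hlift k hk]
    · intro K k hk
      ext x e
      exact hlift k hk x e
    · intro K k hk m hm
      rw [← cancel_mono f, hm]
      ext x e
      exact (hlift k hk x e).symm }⟩

/-- A map which is surjective on stalks is the cokernel of its kernel. -/
theorem nonempty_normalEpi (f : E ⟶ F) [Epi f] : Nonempty (NormalEpi f) := ⟨{
  W := ker f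
  g := kerι f
  w := kerι_comp f
  isColimit := by
    have hker : ∀ {K : RationalGSheaf G X} (k : E ⟶ K), kerι f ≫ k = 0 → ∀ x,
        LinearMap.ker (f.app x) ≤ LinearMap.ker (k.app x) := fun {K} k hk x e he =>
      congrArg (fun m : ker f ⟶ K => Hom.app m x (⟨e, he⟩ : LinearMap.ker (f.app x))) hk
    let desc {K : RationalGSheaf G X} (k : E ⟶ K) (hk : kerι f ≫ k = 0) (x : X) :
        F.stalk x →ₗ[ℚ] K.stalk x :=
      ((LinearMap.ker (f.app x)).liftQ (k.app x) (hker k hk x)).comp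
        ((f.app x).quotKerEquivOfSurjective (surjective_of_epi f x)).symm.toLinearMap
    have hdesc : ∀ {K : RationalGSheaf G X} (k : E ⟶ K) (hk : kerι f ≫ k = 0) (x : X)
        (e : E.stalk x), desc k hk x (f.app x e) = k.app x e := fun k hk x e => by
      have : ((f.app x).quotKerEquivOfSurjective (surjective_of_epi f x)).symm (f.app x e) =
          Submodule.Quotient.mk e := by
        rw [LinearEquiv.symm_apply_eq]
        rfl
      simp only [desc, LinearMap.comp_apply, LinearEquiv.coe_coe, this]
      rfl
    refine CokernelCofork.IsColimit.ofπ _ _ (fun {K} k hk => homOfSections (desc k hk) ?_ ?_) ?_ ?_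
    · intro g x y h e
      obtain ⟨e, rfl⟩ := surjective_of_epi f x e
      rw [← f.equivariant, hdesc k hk, hdesc k hk, k.equivariant]
    · intro s x hs
      obtain ⟨w, hw⟩ := surjective_of_epi f x (s x)
      obtain ⟨t, htx, ht⟩ := exists_section E.isLocalHomeomorph ⟨x, w⟩
      change t x = _ at htx
      change ContinuousAt (tot t) x at ht
      refine (section_map k ht).congr ?_
      filter_upwards [eventually_eq F.isLocalHomeomorph _ _ x (section_map f ht) hs
        (by rw [htx, hw])] with y hy
      simp only [tot, Total.mk.injEq, heq_eq_eq, true_and]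
      rw [← hy, hdesc k hk]
    · intro K k hk
      ext x e
      exact hdesc k hk x e
    · intro K k hk m hm
      rw [← cancel_epi f, hm]
      ext x e
      exact (hdesc k hk x e).symm }⟩

/-- The category of rational `G`-sheaves over `X` is abelian. -/
noncomputable instance [ContinuousSMul G X] : Abelian (RationalGSheaf G X) where
  normalMonoOfMono f _ := nonempty_normalMono f
  normalEpiOfEpi f _ := nonempty_normalEpi f
  has_finite_products := hasFiniteProducts_of_has_binary_and_terminal

end EquivariantSheaf

/-! ### The Godement sheaf of a rational `G`-sheaf -/

namespace EquivariantSheaf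

/-! Every sheaf `E` embeds in an injective one whose quotient by `E` is supported one
Cantor–Bendixson stage further down, so an injective resolution stops after `n` steps.

The injective is an equivariant Godement sheaf `godement E`: its stalk at `x` consists of germs of
discontinuous sections that are equivariant, near `x`, under group elements near `1`. This
smoothness makes the action continuous. Evaluating germs identifies maps `B ⟶ godement E` with
equivariant families of linear maps `B.stalk x → E.stalk x`, with no continuity required
(`godementLift`, `godementLift_eval`).

Such families extend along monomorphisms (`exists_equivariant_extension`): one extends over `ℚ` at
one point of each orbit, averages over its compact stabilizer, where orbits of vectors are locally
constant and averages are finite sums, and transports along the orbit. Hence `injective_godement`.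

If `E` is supported on a closed set `S` and `x` is not an accumulation point of `S`, a germ at `x`
is determined by its value at `x`, so `E` and `godement E` agree there (`toGodement_surjective`).
The cokernel thus lives on the derived set of `S`, and dimension shifting
(`hasInjectiveDimensionLT_of_isSupportedOn`) concludes. -/

theorem eventually_continuousAt_tot {X : Type u} {S : X → Type u} [TopologicalSpace X]
    [TopologicalSpace (Total S)] (hS : IsLocalHomeomorph (Total.base : Total S → X))
    {s : ∀ y, S y} {x : X} (hs : ContinuousAt (tot s) x) :
    ∀ᶠ y in 𝓝 x, ContinuousAt (tot s) y := by
  obtain ⟨U, hU, hinj⟩ := exists_injOn hS (tot s x)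
  obtain ⟨O, hOU, hO, hxO⟩ := mem_nhds_iff.1 hU
  filter_upwards [(hs.eventually_mem (hO.mem_nhds hxO)).eventually_nhds] with y hy
  intro W hW
  -- The base map sends neighbourhoods to neighbourhoods; as it is injective on `O`, the point of `W
  -- ∩ O` over `z` can only be `tot s z`.
  have hb : Total.base '' (W ∩ O) ∈ 𝓝 y := by
    have := hS.map_nhds_eq (tot s y)
    rw [show (tot s y).base = y from rfl] at this
    rw [← this]
    exact image_mem_map (inter_mem hW (hO.mem_nhds hy.self_of_nhds))
  rw [mem_map]
  filter_upwards [hb, hy] with z hz hzO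
  obtain ⟨e, ⟨heW, heO⟩, rfl⟩ := hz
  have : tot s e.base = e := hinj (hOU hzO) (hOU heO) rfl
  rwa [Set.mem_preimage, this]

variable {G : Type v} {X : Type u} [Group G] [TopologicalSpace G] [TopologicalSpace X]
  [MulAction G X]

/-- The group element also occurs in the type of a proof argument of `act`, which obstructs direct
rewriting. -/
theorem act_congr (E : RationalGSheaf G X) {g k : G} (hgk : g = k) {x y : X} (hg : g • x = y)
    (hk : k • x = y) (e : E.stalk x) : E.act g hg e = E.act k hk e := by
  subst hgk
  rfl

/-- Translation of discontinuous sections by a group element. -/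
def translate (E : RationalGSheaf G X) (g : G) : (∀ y, E.stalk y) →ₗ[ℚ] (∀ y, E.stalk y) :=
  LinearMap.pi fun z => E.act g (smul_inv_smul g z) ∘ₗ LinearMap.proj (g⁻¹ • z)

/-- Leaving `y` free avoids casts along `g • g⁻¹ • z = z`. -/
theorem translate_apply (E : RationalGSheaf G X) {g : G} {y z : X} (h : g • y = z)
    (s : ∀ y, E.stalk y) : translate E g s z = E.act g h (s y) := by
  obtain rfl : y = g⁻¹ • z := by rw [← h, inv_smul_smul]
  rfl

theorem translate_one (E : RationalGSheaf G X) (s : ∀ y, E.stalk y) : translate E 1 s = s := by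
  ext y
  rw [translate_apply E (one_smul G y), E.act_one]

theorem translate_mul (E : RationalGSheaf G X) (g k : G) (s : ∀ y, E.stalk y) :
    translate E (g * k) s = translate E g (translate E k s) := by
  ext z
  rw [translate_apply E (smul_inv_smul g z), translate_apply E (smul_inv_smul k (g⁻¹ • z)),
    translate_apply E (y := k⁻¹ • g⁻¹ • z) (by rw [mul_smul, smul_inv_smul, smul_inv_smul]),
    E.act_mul]

/-- The discontinuous sections whose germ at `x` is zero. -/
def nullGerms (E : RationalGSheaf G X) (x : X) : Submodule ℚ (∀ y, E.stalk y) where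
  carrier := {s | ∀ᶠ y in 𝓝 x, s y = 0}
  add_mem' hs ht := by
    filter_upwards [hs, ht] with y h1 h2
    simp [h1, h2]
  zero_mem' := Eventually.of_forall fun _ => rfl
  smul_mem' q s hs := by
    filter_upwards [hs] with y h
    simp [h]

/-- The discontinuous sections which, near `x`, are equivariant for group elements near `1`. -/
def smoothGerms (E : RationalGSheaf G X) (x : X) : Submodule ℚ (∀ y, E.stalk y) where
  carrier := {s | ∀ᶠ p : G × X in 𝓝 (1, x), s (p.1 • p.2) = E.act p.1 rfl (s p.2)}
  add_mem' hs ht := by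
    filter_upwards [hs, ht] with p h1 h2
    simp [h1, h2]
  zero_mem' := Eventually.of_forall fun p => by simp
  smul_mem' q s hs := by
    filter_upwards [hs] with p h
    simp [h]

theorem mem_smoothGerms {E : RationalGSheaf G X} {x : X} {s : ∀ y, E.stalk y} :
    s ∈ smoothGerms E x ↔
      ∀ᶠ p : G × X in 𝓝 (1, x), s (p.1 • p.2) = E.act p.1 rfl (s p.2) := Iff.rfl

/-- Smoothness is an open condition, so near a smooth point the default value `0` of `germSec` never
occurs. -/
theorem eventually_mem_smoothGerms {E : RationalGSheaf G X} {x : X} {s : ∀ y, E.stalk y}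
    (hs : s ∈ smoothGerms E x) : ∀ᶠ y in 𝓝 x, s ∈ smoothGerms E y :=
  (Continuous.prodMk_right (1 : G)).continuousAt.eventually
    (eventually_eventually_nhds.2 (mem_smoothGerms.1 hs))

/-- The stalk of the Godement sheaf: germs of smooth discontinuous sections. -/
abbrev GodementStalk (E : RationalGSheaf G X) (x : X) : Type u :=
  smoothGerms E x ⧸ (nullGerms E x).comap (smoothGerms E x).subtype

def germ {E : RationalGSheaf G X} {x : X} (s : ∀ y, E.stalk y) (hs : s ∈ smoothGerms E x) :
    GodementStalk E x :=
  Submodule.Quotient.mk ⟨s, hs⟩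

theorem exists_germ {E : RationalGSheaf G X} {x : X} (e : GodementStalk E x) :
    ∃ (s : ∀ y, E.stalk y) (hs : s ∈ smoothGerms E x), germ s hs = e := by
  obtain ⟨⟨s, hs⟩, rfl⟩ := Submodule.Quotient.mk_surjective _ e
  exact ⟨s, hs, rfl⟩

theorem germ_eq_iff {E : RationalGSheaf G X} {x : X} {s t : ∀ y, E.stalk y}
    {hs : s ∈ smoothGerms E x} {ht : t ∈ smoothGerms E x} :
    germ s hs = germ t ht ↔ ∀ᶠ y in 𝓝 x, s y = t y := by
  rw [germ, germ, Submodule.Quotient.eq]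
  change (∀ᶠ y in 𝓝 x, s y - t y = 0) ↔ _
  simp_rw [sub_eq_zero]

open Classical in
/-- The section of the Godement sheaf given by a discontinuous section, where this is smooth. -/
noncomputable def germSec {E : RationalGSheaf G X} (s : ∀ y, E.stalk y) (y : X) :
    GodementStalk E y :=
  if h : s ∈ smoothGerms E y then germ s h else 0

theorem germSec_eq {E : RationalGSheaf G X} {x : X} {s : ∀ y, E.stalk y}
    (hs : s ∈ smoothGerms E x) : germSec s x = germ s hs :=
  dif_pos hs

theorem germSec_eventually_eq {E : RationalGSheaf G X} {x : X} {s t : ∀ y, E.stalk y}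
    (hs : s ∈ smoothGerms E x) (ht : t ∈ smoothGerms E x) (h : ∀ᶠ y in 𝓝 x, s y = t y) :
    ∀ᶠ y in 𝓝 x, germSec s y = germSec t y := by
  filter_upwards [eventually_mem_smoothGerms hs, eventually_mem_smoothGerms ht,
    h.eventually_nhds] with y h1 h2 h3
  rw [germSec_eq h1, germSec_eq h2, germ_eq_iff]
  exact h3

/-- The finest topology making each `tot (germSec s)` continuous at the points where `s` is smooth.
-/
instance godementTopology (E : RationalGSheaf G X) :
    TopologicalSpace (Total (GodementStalk E)) where
  IsOpen W := ∀ x (s : ∀ y, E.stalk y), s ∈ smoothGerms E x → tot (germSec s) x ∈ W →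
    ∀ᶠ y in 𝓝 x, tot (germSec s) y ∈ W
  isOpen_univ _ _ _ _ := univ_mem
  isOpen_inter _ _ h1 h2 x s hs hx := (h1 x s hs hx.1).and (h2 x s hs hx.2)
  isOpen_sUnion _ h x s hs := by
    rintro ⟨W, hW, hxW⟩
    filter_upwards [h W hW x s hs hxW] with y hy
    exact ⟨W, hW, hy⟩

variable {E : RationalGSheaf G X}

theorem continuousAt_germSec {x : X} {s : ∀ y, E.stalk y} (hs : s ∈ smoothGerms E x) :
    ContinuousAt (tot (germSec s)) x := by
  intro W hW
  obtain ⟨O, hOW, hO, hxO⟩ := mem_nhds_iff.1 hW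
  exact (hO x s hs hxO).mono fun y hy => hOW hy

variable (E) in
theorem godement_isLocalHomeomorph :
    IsLocalHomeomorph (Total.base : Total (GodementStalk E) → X) := by
  refine isLocalHomeomorph_of_sections ?_ ?_ ?_
  · refine continuous_def.2 fun U hU x s _ hx => ?_
    exact hU.mem_nhds hx
  · rintro ⟨x, e⟩
    obtain ⟨s, hs, rfl⟩ := exists_germ e
    -- The sheet swept out by the germs of `s`. It is open because representatives with equal germs
    -- at a point have equal germs at all nearby points.
    refine ⟨{p | p = tot (germSec s) p.base ∧ s ∈ smoothGerms E p.base},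
      IsOpen.mem_nhds (fun y t ht hy => ?_) ⟨by rw [tot, germSec_eq hs], hs⟩, ?_⟩
    · obtain ⟨h1, h2⟩ := hy
      change s ∈ smoothGerms E y at h2
      have h3 : germSec t y = germSec s y := by simpa [tot] using h1
      rw [germSec_eq ht, germSec_eq h2, germ_eq_iff] at h3
      filter_upwards [germSec_eventually_eq ht h2 h3, eventually_mem_smoothGerms h2] with z hz hsz
      exact ⟨congrArg (Total.mk z) hz, hsz⟩
    · intro p hp q hq hpq
      rw [hp.1, hq.1, hpq]
  · rintro ⟨x, e⟩
    obtain ⟨s, hs, rfl⟩ := exists_germ e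
    exact ⟨germSec s, germSec_eq hs, continuousAt_germSec hs⟩

/-- Reduces continuity questions on the Godement sheaf to sections of the form `germSec s`. -/
theorem exists_germSec {σ : ∀ y, GodementStalk E y} {x : X} (hσ : ContinuousAt (tot σ) x) :
    ∃ s ∈ smoothGerms E x, ∀ᶠ y in 𝓝 x, σ y = germSec s y := by
  obtain ⟨s, hs, h⟩ := exists_germ (σ x)
  exact ⟨s, hs, eventually_eq (godement_isLocalHomeomorph E) σ (germSec s) x hσ
    (continuousAt_germSec hs) (by rw [germSec_eq hs, h])⟩

/-! ### The group action on germs -/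

section Action

variable [IsTopologicalGroup G] [ContinuousSMul G X]

theorem translate_mem_smoothGerms {g : G} {x y : X} (h : g • x = y) {s : ∀ y, E.stalk y}
    (hs : s ∈ smoothGerms E x) : translate E g s ∈ smoothGerms E y := by
  -- Equivariance of the translate under `k` at `z` is that of `s` under the conjugate `g⁻¹ * k * g`
  -- at `g⁻¹ • z`.
  have hc : ContinuousAt (fun p : G × X => (g⁻¹ * p.1 * g, g⁻¹ • p.2)) (1, y) := by fun_prop
  have hs' := mem_smoothGerms.1 hs
  rw [ContinuousAt, show (g⁻¹ * (1 : G) * g, g⁻¹ • y) = (1, x) by simp [← h]] at hc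
  rw [mem_smoothGerms]
  filter_upwards [hc.eventually hs'] with p hp
  have e1 : (g⁻¹ * p.1 * g) • g⁻¹ • p.2 = g⁻¹ • p.1 • p.2 := by simp [mul_smul]
  have e2 : g • (g⁻¹ * p.1 * g) • g⁻¹ • p.2 = p.1 • p.2 := by rw [e1, smul_inv_smul]
  rw [translate_apply E e2, hp, translate_apply E (smul_inv_smul g p.2),
    ← E.act_mul _ _ (by simp [mul_smul]), ← E.act_mul _ _ (by simp [mul_smul])]
  exact act_congr E (by group) _ _ _

theorem translate_mem_nullGerms {g : G} {x y : X} (h : g • x = y) {s : ∀ y, E.stalk y}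
    (hs : s ∈ nullGerms E x) : translate E g s ∈ nullGerms E y := by
  have hc : Tendsto (fun z : X => g⁻¹ • z) (𝓝 y) (𝓝 x) := by
    have := (continuous_const_smul (T := X) g⁻¹).tendsto y
    rwa [← h, inv_smul_smul, h] at this
  change ∀ᶠ z in 𝓝 y, _
  filter_upwards [hc.eventually hs] with z hz
  rw [translate_apply E (smul_inv_smul g z), hz, map_zero]

/-- The action of a group element on the stalks of the Godement sheaf. -/
def germAct (E : RationalGSheaf G X) (g : G) {x y : X} (h : g • x = y) :
    GodementStalk E x →ₗ[ℚ] GodementStalk E y :=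
  Submodule.mapQ _ _ ((translate E g).restrict fun _ hs => translate_mem_smoothGerms h hs)
    fun _ hs => translate_mem_nullGerms h hs

theorem germAct_germ (g : G) {x y : X} (h : g • x = y) {s : ∀ y, E.stalk y}
    (hs : s ∈ smoothGerms E x) :
    germAct E g h (germ s hs) = germ (translate E g s) (translate_mem_smoothGerms h hs) := rfl

/-- Translations by `g'` and `g` differ by `g⁻¹ * g'`, which is near `1` and so fixes the germ of a
smooth section. Continuity of the action rests on this. -/
theorem translate_eventually_eq {x : X} {s : ∀ y, E.stalk y} (hs : s ∈ smoothGerms E x) (g : G) :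
    ∀ᶠ p : G × X in 𝓝 (g, x), ∀ᶠ z in 𝓝 (p.1 • p.2), translate E p.1 s z = translate E g s z := by
  have hc : ContinuousAt (fun p : G × X => (g⁻¹ * p.1, p.2)) (g, x) := by fun_prop
  rw [ContinuousAt, inv_mul_cancel] at hc
  filter_upwards [hc.eventually (eventually_eventually_nhds.2 (mem_smoothGerms.1 hs))] with p hp
  have hd : ContinuousAt (fun z : X => (g⁻¹ * p.1, p.1⁻¹ • z)) (p.1 • p.2) := by fun_prop
  rw [ContinuousAt, inv_smul_smul] at hd
  filter_upwards [hd.eventually hp] with z hz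
  have e1 : (g⁻¹ * p.1) • p.1⁻¹ • z = g⁻¹ • z := by simp [mul_smul]
  have e2 : g • (g⁻¹ * p.1) • p.1⁻¹ • z = z := by rw [e1, smul_inv_smul]
  rw [translate_apply E (smul_inv_smul p.1 z), translate_apply E e2, hz,
    ← E.act_mul _ _ (by simp)]
  exact act_congr E (by group) _ _ _

/-- The Godement sheaf of a rational `G`-sheaf. -/
noncomputable def godement (E : RationalGSheaf G X) : RationalGSheaf G X where
  stalk := GodementStalk E
  topology := godementTopology E
  isLocalHomeomorph := godement_isLocalHomeomorph E
  continuous_add := by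
    refine FibreProduct.continuous_of_sections (godement_isLocalHomeomorph E)
      (godement_isLocalHomeomorph E) _ fun σ τ x hσ hτ => ?_
    obtain ⟨s, hs, hσs⟩ := exists_germSec hσ
    obtain ⟨t, ht, hτt⟩ := exists_germSec hτ
    refine (continuousAt_germSec (add_mem hs ht)).congr ?_
    filter_upwards [hσs, hτt, eventually_mem_smoothGerms hs, eventually_mem_smoothGerms ht]
      with y h1 h2 h3 h4
    rw [h1, h2, tot, germSec_eq h3, germSec_eq h4, germSec_eq (add_mem h3 h4)]
    rfl
  continuous_smul q := by
    refine EquivariantSheaf.continuous_of_sections (godement_isLocalHomeomorph E) _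
      fun σ x hσ => ?_
    obtain ⟨s, hs, hσs⟩ := exists_germSec hσ
    refine (continuousAt_germSec (Submodule.smul_mem _ q hs)).congr ?_
    filter_upwards [hσs, eventually_mem_smoothGerms hs] with y h1 h2
    simp only [tot]
    rw [h1, germSec_eq h2, germSec_eq (Submodule.smul_mem _ q h2)]
    rfl
  act := germAct E
  act_one h e := by
    obtain ⟨s, hs, rfl⟩ := exists_germ e
    rw [germAct_germ, germ_eq_iff, translate_one]
    exact Eventually.of_forall fun _ => rfl
  act_mul hk hg hgk e := by
    obtain ⟨s, hs, rfl⟩ := exists_germ e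
    rw [germAct_germ, germAct_germ, germAct_germ, germ_eq_iff, translate_mul]
    exact Eventually.of_forall fun _ => rfl
  continuous_act := by
    rw [continuous_iff_continuousAt]
    rintro ⟨g, x, e⟩
    obtain ⟨s, hs, rfl⟩ := exists_germ e
    have hx : (⟨x, germ s hs⟩ : Total (GodementStalk E)) = tot (germSec s) x := by
      rw [tot, germSec_eq hs]
    -- Points near the germ are `tot (germSec s) y` with `y` near `x`; it remains to show that the
    -- action carries them, for `g'` near `g`, into the single section `germSec (translate E g s)`.
    rw [hx, ContinuousAt, nhds_prod_eq,
      nhds_eq_map (godement_isLocalHomeomorph E) _ x (continuousAt_germSec hs),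
      Filter.prod_map_right, tendsto_map'_iff, ← nhds_prod_eq]
    have hg := translate_mem_smoothGerms (rfl : g • x = g • x) hs
    have hsmul : Tendsto (fun p : G × X => p.1 • p.2) (𝓝 (g, x)) (𝓝 (g • x)) :=
      (continuous_smul (M := G) (X := X)).tendsto (g, x)
    have key : Tendsto (fun p : G × X => tot (germSec (translate E g s)) (p.1 • p.2))
        (𝓝 (g, x)) (𝓝 (tot (germSec (translate E g s)) (g • x))) :=
      (continuousAt_germSec hg).tendsto.comp hsmul
    have heq : tot (germSec (translate E g s)) (g • x) =
        ⟨g • x, germAct E g rfl (germSec s x)⟩ := by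
      rw [tot, germSec_eq hg, germSec_eq hs, germAct_germ]
    change Tendsto _ _ (𝓝 (⟨g • x, germAct E g rfl (germSec s x)⟩ : Total (GodementStalk E)))
    rw [← heq]
    refine key.congr' ?_
    filter_upwards [hsmul.eventually (eventually_mem_smoothGerms hg),
      translate_eventually_eq hs g,
      (continuous_snd.tendsto (g, x)).eventually (eventually_mem_smoothGerms hs)] with p h1 h2 h3
    change _ = (⟨p.1 • p.2, germAct E p.1 rfl (germSec s p.2)⟩ : Total (GodementStalk E))
    rw [tot, germSec_eq h1, germSec_eq h3, germAct_germ]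
    refine congrArg (Total.mk _) (germ_eq_iff.2 ?_)
    exact h2.mono fun _ h => h.symm

end Action

end EquivariantSheaf

namespace EquivariantSheaf

variable {G : Type v} {X : Type u} [Group G] [TopologicalSpace G] [TopologicalSpace X]
  [MulAction G X] [IsTopologicalGroup G] [ContinuousSMul G X]

/-! #### Maps into the Godement sheaf -/

/-- As `(k, y)` tends to `(1, x)`, both `s (k • y)` and `k` applied to `s y` tend to `tot s x`. They
lie over the same point, so they agree once inside a set where the projection is injective. -/
theorem section_mem_smoothGerms {B : RationalGSheaf G X} {s : ∀ y, B.stalk y} {x : X}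
    (hs : ContinuousAt (tot s) x) : s ∈ smoothGerms B x := by
  obtain ⟨U, hU, hinj⟩ := exists_injOn B.isLocalHomeomorph (tot s x)
  have h1 : Tendsto (fun p : G × X => tot s (p.1 • p.2)) (𝓝 (1, x)) (𝓝 (tot s x)) := by
    have h : Tendsto (fun p : G × X => p.1 • p.2) (𝓝 (1, x)) (𝓝 x) := by
      simpa using (continuous_smul (M := G) (X := X)).tendsto (1, x)
    exact hs.tendsto.comp h
  have h2 : Tendsto (fun p : G × X => (⟨p.1 • p.2, B.act p.1 rfl (s p.2)⟩ : Total B.stalk))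
      (𝓝 (1, x)) (𝓝 (tot s x)) := by
    have h3 : Tendsto (fun p : G × X => (p.1, tot s p.2)) (𝓝 (1, x)) (𝓝 (1, tot s x)) := by
      rw [nhds_prod_eq, nhds_prod_eq]
      exact tendsto_id.prodMap hs
    have h4 : (⟨(1 : G) • x, B.act 1 rfl (s x)⟩ : Total B.stalk) = tot s x := by
      have key : ∀ (y : X) (h : (1 : G) • x = y),
          (⟨y, B.act 1 h (s x)⟩ : Total B.stalk) = tot s x := by
        intro y h
        obtain rfl : x = y := by rw [← h, one_smul]
        rw [B.act_one, tot]
      exact key _ rfl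
    have h5 := (B.continuous_act.tendsto (1, tot s x)).comp h3
    have h6 : 𝓝 (⟨(1 : G) • x, B.act 1 rfl (s x)⟩ : Total B.stalk) = 𝓝 (tot s x) := by rw [h4]
    exact h5.trans h6.le
  rw [mem_smoothGerms]
  filter_upwards [h1 hU, h2 hU] with p hp1 hp2
  have := hinj hp1 hp2 rfl
  simpa [tot] using this

variable {A B E : RationalGSheaf G X}

/-- Equivariance of a stalkwise linear family of maps, which need not be continuous. -/
def IsEquivariantFamily (ψ : ∀ x, B.stalk x →ₗ[ℚ] E.stalk x) : Prop :=
  ∀ (g : G) {x y : X} (h : g • x = y) (e : B.stalk x), ψ y (B.act g h e) = E.act g h (ψ x e)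

theorem map_mem_smoothGerms {ψ : ∀ x, B.stalk x →ₗ[ℚ] E.stalk x} (hψ : IsEquivariantFamily ψ)
    {s : ∀ y, B.stalk y} {x : X} (hs : s ∈ smoothGerms B x) :
    (fun y => ψ y (s y)) ∈ smoothGerms E x := by
  rw [mem_smoothGerms] at hs ⊢
  filter_upwards [hs] with p hp
  rw [hp, hψ]

/-- Two sections through `b` agree near `x`, so the germ of the image does not depend on the
section. -/
theorem exists_godementLift_germ {ψ : ∀ x, B.stalk x →ₗ[ℚ] E.stalk x}
    (hψ : IsEquivariantFamily ψ) (x : X) (b : B.stalk x) :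
    ∃ e : GodementStalk E x, ∀ (s : ∀ y, B.stalk y) (hs : ContinuousAt (tot s) x), s x = b →
      e = germ (fun y => ψ y (s y)) (map_mem_smoothGerms hψ (section_mem_smoothGerms hs)) := by
  obtain ⟨t, htx, ht⟩ := exists_section B.isLocalHomeomorph ⟨x, b⟩
  change t x = b at htx
  change ContinuousAt (tot t) x at ht
  refine ⟨germ (fun y => ψ y (t y)) (map_mem_smoothGerms hψ (section_mem_smoothGerms ht)),
    fun s hs hsx => ?_⟩
  rw [germ_eq_iff]
  filter_upwards [eventually_eq B.isLocalHomeomorph t s x ht hs (htx.trans hsx.symm)] with y hy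
  rw [hy]

/-- The germ at `x` of the image under `ψ` of a local section through `b`. -/
noncomputable def godementLiftFun {ψ : ∀ x, B.stalk x →ₗ[ℚ] E.stalk x}
    (hψ : IsEquivariantFamily ψ) (x : X) (b : B.stalk x) : GodementStalk E x :=
  (exists_godementLift_germ hψ x b).choose

theorem godementLiftFun_eq {ψ : ∀ x, B.stalk x →ₗ[ℚ] E.stalk x} (hψ : IsEquivariantFamily ψ)
    {x : X} {s : ∀ y, B.stalk y} (hs : ContinuousAt (tot s) x) :
    godementLiftFun hψ x (s x) =
      germ (fun y => ψ y (s y)) (map_mem_smoothGerms hψ (section_mem_smoothGerms hs)) :=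
  (exists_godementLift_germ hψ x (s x)).choose_spec s hs rfl

theorem exists_section_eq (B : RationalGSheaf G X) {x : X} (b : B.stalk x) :
    ∃ s : ∀ y, B.stalk y, s x = b ∧ ContinuousAt (tot s) x :=
  exists_section B.isLocalHomeomorph ⟨x, b⟩

theorem section_translate {s : ∀ y, B.stalk y} {x y : X} (hs : ContinuousAt (tot s) x) {g : G}
    (h : g • x = y) : ContinuousAt (tot (translate B g s)) y := by
  have h1 : ContinuousAt (fun z : X => g⁻¹ • z) y := (continuous_const_smul g⁻¹).continuousAt
  have hx : g⁻¹ • y = x := by rw [← h, inv_smul_smul]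
  have h2 : ContinuousAt (fun z : X => (g, tot s (g⁻¹ • z))) y := by
    refine continuousAt_const.prodMk (ContinuousAt.comp (g := tot s) ?_ h1)
    rwa [hx]
  refine (B.continuous_act.continuousAt.comp h2).congr (Eventually.of_forall fun z => ?_)
  have key : ∀ (w : X) (hw : g • g⁻¹ • z = w),
      (⟨w, B.act g hw (s (g⁻¹ • z))⟩ : Total B.stalk) = tot (translate B g s) w := by
    intro w hw
    rw [tot, translate_apply B hw]
  exact (key _ rfl).trans (congrArg (tot (translate B g s)) (smul_inv_smul g z))

/-- The map to the Godement sheaf determined by an equivariant family of linear maps. -/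
noncomputable def godementLift {ψ : ∀ x, B.stalk x →ₗ[ℚ] E.stalk x}
    (hψ : IsEquivariantFamily ψ) : B ⟶ godement E :=
  homOfSections (E := B) (F := godement E)
    (fun x =>
      { toFun := godementLiftFun hψ x
        map_add' := fun a b => by
          obtain ⟨s, rfl, hs⟩ := exists_section_eq B a
          obtain ⟨t, rfl, ht⟩ := exists_section_eq B b
          rw [godementLiftFun_eq hψ hs, godementLiftFun_eq hψ ht,
            godementLiftFun_eq hψ (section_add hs ht)]
          refine germ_eq_iff (ht := add_mem (map_mem_smoothGerms hψ (section_mem_smoothGerms hs))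
            (map_mem_smoothGerms hψ (section_mem_smoothGerms ht))) |>.2 ?_
          exact Eventually.of_forall fun y => map_add _ _ _
        map_smul' := fun q a => by
          obtain ⟨s, rfl, hs⟩ := exists_section_eq B a
          rw [godementLiftFun_eq hψ hs, godementLiftFun_eq hψ (section_smul q hs)]
          refine germ_eq_iff (ht := Submodule.smul_mem _ q
            (map_mem_smoothGerms hψ (section_mem_smoothGerms hs))) |>.2 ?_
          exact Eventually.of_forall fun y => map_smul _ _ _ })
    (fun g x y h e => by
      obtain ⟨s, rfl, hs⟩ := exists_section_eq B e
      have h1 := section_translate hs h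
      change godementLiftFun hψ y (B.act g h (s x)) = germAct E g h (godementLiftFun hψ x (s x))
      rw [← translate_apply B h, godementLiftFun_eq hψ h1, godementLiftFun_eq hψ hs,
        germAct_germ, germ_eq_iff]
      refine Eventually.of_forall fun z => ?_
      rw [translate_apply B (smul_inv_smul g z), translate_apply E (smul_inv_smul g z), hψ])
    (fun s x hs => by
      refine (continuousAt_germSec
        (map_mem_smoothGerms hψ (section_mem_smoothGerms hs))).congr ?_
      -- At nearby points `y` the same `s` is still a section through `s y`, hence computes the lift
      -- there too.
      filter_upwards [eventually_continuousAt_tot B.isLocalHomeomorph hs] with y hy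
      exact congrArg (Total.mk y) ((germSec_eq _).trans (godementLiftFun_eq hψ hy).symm))

theorem godementLift_app {ψ : ∀ x, B.stalk x →ₗ[ℚ] E.stalk x} (hψ : IsEquivariantFamily ψ)
    {x : X} {s : ∀ y, B.stalk y} (hs : ContinuousAt (tot s) x) :
    (godementLift hψ).app x (s x) =
      germ (fun y => ψ y (s y)) (map_mem_smoothGerms hψ (section_mem_smoothGerms hs)) :=
  godementLiftFun_eq hψ hs

/-- Evaluation of germs. -/
def godementEval (E : RationalGSheaf G X) (x : X) : (godement E).stalk x →ₗ[ℚ] E.stalk x :=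
  Submodule.liftQ _ (LinearMap.proj x ∘ₗ (smoothGerms E x).subtype) fun s hs => by
    have hs' : ∀ᶠ y in 𝓝 x, s.1 y = 0 := hs
    exact hs'.self_of_nhds

theorem godementEval_germ {x : X} {s : ∀ y, E.stalk y} (hs : s ∈ smoothGerms E x) :
    godementEval E x (germ s hs) = s x := rfl

theorem godementEval_equivariant (E : RationalGSheaf G X) :
    IsEquivariantFamily (godementEval E) := by
  intro g x y h e
  obtain ⟨s, hs, rfl⟩ := exists_germ e
  change godementEval E y (germAct E g h (germ s hs)) = _
  rw [germAct_germ, godementEval_germ, godementEval_germ, translate_apply E h]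

/-- The uniqueness half of the universal property: a map into the Godement sheaf is recovered from
its values under evaluation. -/
theorem godementLift_eval (f : A ⟶ godement E)
    (hψ : IsEquivariantFamily fun x => godementEval E x ∘ₗ f.app x) : godementLift hψ = f := by
  ext x a
  obtain ⟨s, rfl, hs⟩ := exists_section_eq A a
  obtain ⟨t, ht, hst⟩ := exists_germSec (section_map f hs)
  rw [godementLift_app hψ hs, hst.self_of_nhds, germSec_eq ht]
  refine germ_eq_iff.2 ?_
  filter_upwards [hst, eventually_mem_smoothGerms ht] with y h1 h2
  rw [LinearMap.comp_apply, h1, germSec_eq h2, godementEval_germ]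

theorem comp_godementLift (i : A ⟶ B) {ψ : ∀ x, B.stalk x →ₗ[ℚ] E.stalk x}
    (hψ : IsEquivariantFamily ψ) {φ : ∀ x, A.stalk x →ₗ[ℚ] E.stalk x}
    (hφ : IsEquivariantFamily φ) (h : ∀ x a, ψ x (i.app x a) = φ x a) :
    i ≫ godementLift hψ = godementLift hφ := by
  ext x a
  obtain ⟨s, rfl, hs⟩ := exists_section_eq A a
  rw [comp_app, godementLift_app hψ (section_map i hs), godementLift_app hφ hs]
  refine germ_eq_iff.2 ?_
  exact Eventually.of_forall fun y => h y _

theorem isEquivariantFamily_id (E : RationalGSheaf G X) :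
    IsEquivariantFamily (B := E) (E := E) fun _ => LinearMap.id :=
  fun _ _ _ _ _ => rfl

/-- The canonical map from a rational `G`-sheaf to its Godement sheaf. -/
noncomputable def toGodement (E : RationalGSheaf G X) : E ⟶ godement E :=
  godementLift (isEquivariantFamily_id E)

theorem godementEval_toGodement {x : X} (e : E.stalk x) :
    godementEval E x ((toGodement E).app x e) = e := by
  obtain ⟨s, rfl, hs⟩ := exists_section_eq E e
  rw [toGodement, godementLift_app _ hs, godementEval_germ, LinearMap.id_apply]

/-- Evaluation is a stalkwise left inverse; it need not be continuous. -/
instance mono_toGodement (E : RationalGSheaf G X) : Mono (toGodement E) where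
  right_cancellation a b h := by
    ext x e
    have h1 := congrArg (fun k => godementEval E x (Hom.app k x e)) h
    simpa only [comp_app, godementEval_toGodement] using h1

/-- Where all nearby stalks vanish, except possibly the one at the point itself, all germs of
discontinuous sections are germs of sections. -/
theorem toGodement_surjective {x : X} (hx : ∀ᶠ y in 𝓝[≠] x, Subsingleton (E.stalk y)) :
    Function.Surjective ((toGodement E).app x) := by
  intro e
  obtain ⟨t, ht, rfl⟩ := exists_germ e
  obtain ⟨s, hsx, hs⟩ := exists_section_eq E (t x)
  refine ⟨s x, ?_⟩
  rw [toGodement, godementLift_app _ hs]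
  refine germ_eq_iff.2 ?_
  rw [eventually_nhdsWithin_iff] at hx
  filter_upwards [hx] with y hy
  by_cases h : y = x
  · subst h
    exact hsx
  · have := hy h
    exact Subsingleton.elim _ _

end EquivariantSheaf

/-! ### Averages of locally constant functions on compact groups -/

namespace LocallyConstant

variable {H : Type*} [Group H] [TopologicalSpace H] [IsTopologicalGroup H]
  {V : Type*}

/-- The subgroup of right periods of a function on a group. -/
def periods (f : H → V) : Subgroup H where
  carrier := {m | ∀ h, f (h * m) = f h}
  mul_mem' ha hb h := by rw [← mul_assoc, hb, ha]
  one_mem' h := by rw [mul_one]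
  inv_mem' {m} hm h := by rw [← hm (h * m⁻¹), inv_mul_cancel_right]

/-- Compactness makes local constancy uniform, so the periods contain a neighbourhood of `1`; an
open subgroup of a compact group has finite index. -/
theorem finiteIndex_periods [CompactSpace H] (f : LocallyConstant H V) :
    (periods f).FiniteIndex := by
  have hmem : (periods f : Set H) ∈ 𝓝 1 := by
    have hloc : ∀ h ∈ (Set.univ : Set H), ∀ᶠ p : H × H in 𝓝 (1, h), f (p.2 * p.1) = f p.2 := by
      intro h _
      have h1 : Tendsto (fun p : H × H => p.2 * p.1) (𝓝 (1, h)) (𝓝 h) := by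
        have : Continuous fun p : H × H => p.2 * p.1 := by fun_prop
        simpa using this.tendsto (1, h)
      have h2 : Tendsto (fun p : H × H => p.2) (𝓝 (1, h)) (𝓝 h) := continuous_snd.tendsto (1, h)
      have h3 : ∀ᶠ y in 𝓝 h, f y = f h := f.isLocallyConstant.eventually_eq h
      filter_upwards [h1.eventually h3, h2.eventually h3] with p hp1 hp2
      rw [hp1, hp2]
    have := isCompact_univ.eventually_forall_of_forall_eventually
      (P := fun m h => f (h * m) = f h) hloc
    filter_upwards [this] with m hm
    exact fun h => hm h trivial
  have hopen : IsOpen (periods f : Set H) := Subgroup.isOpen_of_mem_nhds _ hmem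
  have := Subgroup.quotient_finite_of_isOpen _ hopen
  exact Subgroup.finiteIndex_of_finite_quotient

variable [AddCommGroup V] [Module ℚ V]

/-- The average of the values of a function on representatives of the cosets of a subgroup. -/
noncomputable def cosetAverage (N : Subgroup H) (f : H → V) : V :=
  (Nat.card (H ⧸ N) : ℚ)⁻¹ • ∑ᶠ q : H ⧸ N, f q.out

theorem apply_out {N : Subgroup H} {f : H → V} (hf : N ≤ periods f) (h : H) :
    f (h : H ⧸ N).out = f h := by
  obtain ⟨n, hn⟩ := QuotientGroup.mk_out_eq_mul N h
  rw [hn]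
  exact hf n.2 h

/-- Each coset of `N` splits into `[N : M]` cosets of `M`, and this factor cancels. Functions with
different periods can therefore be averaged over a common subgroup. -/
theorem cosetAverage_eq {M N : Subgroup H} [M.FiniteIndex] (hMN : M ≤ N) {f : H → V}
    (hf : N ≤ periods f) : cosetAverage M f = cosetAverage N f := by
  have : N.FiniteIndex := Subgroup.finiteIndex_of_le hMN
  have := Fintype.ofFinite (H ⧸ M)
  have := Fintype.ofFinite (H ⧸ N)
  have := Fintype.ofFinite (N ⧸ M.subgroupOf N)
  let e := Subgroup.quotientEquivProdOfLE hMN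
  have he : ∀ q : H ⧸ M, f q.out = f (e q).1.out := by
    intro q
    induction q using QuotientGroup.induction_on with
    | H h =>
      rw [apply_out (hMN.trans hf)]
      exact (apply_out hf h).symm
  have hsum : ∑ q : H ⧸ M, f q.out =
      (Fintype.card (N ⧸ M.subgroupOf N) : ℚ) • ∑ q : H ⧸ N, f q.out := by
    rw [Finset.sum_congr rfl fun q _ => he q, e.sum_comp fun p => f p.1.out,
      Fintype.sum_prod_type, Finset.smul_sum]
    simp [Nat.cast_smul_eq_nsmul]
  have hne : (Fintype.card (N ⧸ M.subgroupOf N) : ℚ) ≠ 0 := by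
    have : 0 < Fintype.card (N ⧸ M.subgroupOf N) := Fintype.card_pos
    positivity
  rw [cosetAverage, cosetAverage, finsum_eq_sum_of_fintype, finsum_eq_sum_of_fintype, hsum,
    Nat.card_congr e, Nat.card_prod, smul_smul, Nat.card_eq_fintype_card (α := N ⧸ _)]
  congr 1
  push_cast
  field_simp

variable [CompactSpace H]

theorem cosetAverage_periods (f : LocallyConstant H V) {M : Subgroup H} [M.FiniteIndex]
    (hM : M ≤ periods f) : cosetAverage (periods f) f = cosetAverage M f :=
  (cosetAverage_eq hM le_rfl).symm

/-- The average of a locally constant function on a compact group. -/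
noncomputable def average : LocallyConstant H V →ₗ[ℚ] V where
  toFun f := cosetAverage (periods f) f
  map_add' f k := by
    have := finiteIndex_periods f
    have := finiteIndex_periods k
    have h : periods f ⊓ periods k ≤ periods (f + k) := fun m hm h => by
      simp [hm.1 h, hm.2 h]
    have : (periods f ⊓ periods k).FiniteIndex := inferInstance
    rw [cosetAverage_periods _ h, cosetAverage_periods f (M := periods f ⊓ periods k) inf_le_left,
      cosetAverage_periods k (M := periods f ⊓ periods k) inf_le_right, cosetAverage, cosetAverage, cosetAverage, ← smul_add,
      ← finsum_add_distrib (Set.toFinite _) (Set.toFinite _)]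
    rfl
  map_smul' q f := by
    have := finiteIndex_periods f
    have h : periods f ≤ periods (q • f) := fun m hm h => by simp [hm h]
    rw [cosetAverage_periods _ h, cosetAverage, cosetAverage, RingHom.id_apply, smul_comm q,
      smul_finsum q]
    rfl

theorem average_const (v : V) : average (const H v) = v := by
  have h : (⊤ : Subgroup H) ≤ periods (const H v) := fun _ _ _ => rfl
  change cosetAverage _ _ = v
  rw [cosetAverage_periods _ h, cosetAverage]
  have : Subsingleton (H ⧸ (⊤ : Subgroup H)) := QuotientGroup.subsingleton_quotient_top
  have : Unique (H ⧸ (⊤ : Subgroup H)) := Unique.mk' _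
  rw [Nat.card_unique, finsum_unique]
  simp

theorem average_map {W : Type*} [AddCommGroup W] [Module ℚ W] (L : V →ₗ[ℚ] W)
    (f : LocallyConstant H V) : average (f.map L) = L (average f) := by
  have := finiteIndex_periods f
  have h : periods f ≤ periods (f.map L) := fun m hm h => congrArg L (hm h)
  change cosetAverage _ _ = L (cosetAverage _ _)
  rw [cosetAverage_periods _ h, cosetAverage, cosetAverage, map_smul]
  congr 1
  exact (L.toAddMonoidHom.map_finsum (Set.toFinite _)).symm

/-- Left multiplication permutes the left cosets of the group of right periods. -/
theorem average_translate (f k : LocallyConstant H V) (h₀ : H) (hk : ∀ h, k h = f (h₀ * h)) :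
    average k = average f := by
  have := finiteIndex_periods f
  have h : periods f ≤ periods k := fun m hm h => by rw [hk, hk, ← mul_assoc, hm]
  change cosetAverage _ _ = cosetAverage _ _
  rw [cosetAverage_periods _ h, cosetAverage, cosetAverage]
  congr 1
  refine finsum_eq_of_bijective (fun q => h₀ • q) (MulAction.bijective h₀) fun q => ?_
  induction q using QuotientGroup.induction_on with
  | H a =>
    rw [apply_out h, hk]
    exact (apply_out le_rfl (h₀ * a)).symm

end LocallyConstant

/-! ### Injectivity of Godement sheaves -/

namespace EquivariantSheaf

/-! ### Equivariant extension: stabilizers, then orbits -/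

section Extension

variable {G : Type v} {X : Type u} [Group G] [TopologicalSpace G] [TopologicalSpace X]
  [MulAction G X]

theorem act_act_eq (E : RationalGSheaf G X) {a b c d : G} {x y y' z : X} (ha : a • x = y)
    (hb : b • y = z) (hc : c • x = y') (hd : d • y' = z) (h : b * a = d * c) (e : E.stalk x) :
    E.act b hb (E.act a ha e) = E.act d hd (E.act c hc e) := by
  rw [← E.act_mul ha hb (by rw [mul_smul, ha, hb]), ← E.act_mul hc hd (by rw [mul_smul, hc, hd])]
  exact act_congr E h _ _ e

theorem stabilizer_smul {r : X} (h : MulAction.stabilizer G r) : h.1 • r = r := h.2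

/-- Stabilizer orbits move continuously inside one fibre, and fibres of a local homeomorphism are
discrete. -/
theorem eventually_act_eq (E : RationalGSheaf G X) {r : X} (e : E.stalk r)
    (h : MulAction.stabilizer G r) :
    ∀ᶠ k : MulAction.stabilizer G r in 𝓝 h, E.act k.1 (stabilizer_smul k) e = E.act h.1 (stabilizer_smul h) e := by
  have hc : Continuous fun k : MulAction.stabilizer G r =>
      (⟨r, E.act k.1 (stabilizer_smul k) e⟩ : Total E.stalk) := by
    have h1 : Continuous fun k : MulAction.stabilizer G r => (k.1, (⟨r, e⟩ : Total E.stalk)) := by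
      fun_prop
    refine (E.continuous_act.comp h1).congr fun k => ?_
    have key : ∀ (w : X) (hw : k.1 • r = w),
        (⟨w, E.act k.1 hw e⟩ : Total E.stalk) = ⟨r, E.act k.1 (stabilizer_smul k) e⟩ := by
      intro w hw
      obtain rfl : r = w := (stabilizer_smul k).symm.trans hw
      rfl
    exact key _ rfl
  obtain ⟨U, hU, hinj⟩ := exists_injOn E.isLocalHomeomorph ⟨r, E.act h.1 (stabilizer_smul h) e⟩
  filter_upwards [hc.continuousAt hU] with k hk
  simpa using hinj hk (mem_of_mem_nhds hU) rfl

variable {A B E : RationalGSheaf G X}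

/-- The conjugates of a linear map between stalks under the stabilizer of the base point. -/
def conjugates [IsTopologicalGroup G] {r : X} (ρ : B.stalk r →ₗ[ℚ] E.stalk r) (b : B.stalk r) :
    LocallyConstant (MulAction.stabilizer G r) (E.stalk r) where
  toFun h := E.act h.1 (stabilizer_smul h) (ρ (B.act h⁻¹.1 (stabilizer_smul h⁻¹) b))
  isLocallyConstant := by
    refine (IsLocallyConstant.iff_eventually_eq _).2 fun h => ?_
    filter_upwards [eventually_act_eq E (ρ (B.act h⁻¹.1 (stabilizer_smul h⁻¹) b)) h,
      (continuous_inv.tendsto h).eventually (eventually_act_eq B b h⁻¹)] with k h1 h2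
    rw [h2, h1]

theorem conjugates_apply [IsTopologicalGroup G] {r : X} (ρ : B.stalk r →ₗ[ℚ] E.stalk r)
    (b : B.stalk r) (h : MulAction.stabilizer G r) :
    conjugates ρ b h = E.act h.1 (stabilizer_smul h) (ρ (B.act h⁻¹.1 (stabilizer_smul h⁻¹) b)) := rfl

variable [IsTopologicalGroup G] [ContinuousSMul G X] [CompactSpace G] [T2Space X]

/-- Maschke's theorem for the compact stabilizer of a point. -/
theorem exists_stabilizer_extension (i : A ⟶ B) {φ : ∀ x, A.stalk x →ₗ[ℚ] E.stalk x}
    (hφ : IsEquivariantFamily φ) (r : X) (hi : Function.Injective (i.app r)) :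
    ∃ T : B.stalk r →ₗ[ℚ] E.stalk r,
      (∀ (g : G) (h : g • r = r) (b : B.stalk r), T (B.act g h b) = E.act g h (T b)) ∧
      ∀ a, T (i.app r a) = φ r a := by
  have hclosed : IsClosed (MulAction.stabilizer G r : Set G) :=
    isClosed_eq (continuous_id.smul continuous_const) continuous_const
  have : CompactSpace (MulAction.stabilizer G r) := isCompact_iff_compactSpace.1 hclosed.isCompact
  obtain ⟨j, hj⟩ := LinearMap.exists_leftInverse_of_injective (i.app r) (LinearMap.ker_eq_bot.2 hi)
  have hρ : ∀ a, (φ r ∘ₗ j) (i.app r a) = φ r a := fun a =>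
    congrArg (φ r) (LinearMap.congr_fun hj a)
  -- Only the fact that `ρ` extends `φ r` linearly is kept; averaging its conjugates makes it
  -- equivariant.
  generalize φ r ∘ₗ j = ρ at hρ
  refine ⟨LocallyConstant.average ∘ₗ
    { toFun := conjugates ρ
      map_add' := fun a b => ?_
      map_smul' := fun q b => ?_ }, fun g h b => ?_, fun a => ?_⟩
  · ext h
    simp [conjugates_apply]
  · ext h
    simp [conjugates_apply]
  · change LocallyConstant.average (conjugates ρ (B.act g h b)) =
      E.act g h (LocallyConstant.average (conjugates ρ b))
    rw [← LocallyConstant.average_map]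
    let g' : MulAction.stabilizer G r := ⟨g, h⟩
    refine LocallyConstant.average_translate _ _ g'⁻¹ fun k => ?_
    change E.act k.1 (stabilizer_smul k) (ρ (B.act k⁻¹.1 (stabilizer_smul k⁻¹) (B.act g h b))) =
      E.act g h (E.act (g'⁻¹ * k).1 (stabilizer_smul (g'⁻¹ * k)) (ρ (B.act (g'⁻¹ * k)⁻¹.1 (stabilizer_smul (g'⁻¹ * k)⁻¹) b)))
    rw [← E.act_mul (stabilizer_smul (g'⁻¹ * k)) h (by rw [mul_smul, (stabilizer_smul (g'⁻¹ * k)), h]),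
      ← B.act_mul h (stabilizer_smul k⁻¹) (by rw [mul_smul, h, (stabilizer_smul k⁻¹)]),
      act_congr E (show g * (g'⁻¹ * k).1 = k.1 by simp [g']) _ (stabilizer_smul k),
      act_congr B (show (g'⁻¹ * k)⁻¹.1 = k⁻¹.1 * g by simp [g']) _
        (by rw [mul_smul, h, (stabilizer_smul k⁻¹)])]
  · change LocallyConstant.average (conjugates ρ (i.app r a)) = φ r a
    -- On the image of `i` the map is already equivariant, so all conjugates coincide and averaging
    -- changes nothing.
    have : conjugates ρ (i.app r a) = LocallyConstant.const _ (φ r a) := by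
      ext k
      rw [conjugates_apply, ← i.equivariant, hρ, hφ]
      rw [← E.act_mul (stabilizer_smul k⁻¹) (stabilizer_smul k) (by rw [mul_smul, (stabilizer_smul k⁻¹), (stabilizer_smul k)]),
        act_congr E (show k.1 * k⁻¹.1 = 1 by simp) _ (one_smul G r), E.act_one]
      rfl
    rw [this, LocallyConstant.average_const]

/-- With no continuity between stalks to respect, each orbit is treated separately from one
representative. -/
theorem exists_equivariant_extension (i : A ⟶ B) [Mono i] {φ : ∀ x, A.stalk x →ₗ[ℚ] E.stalk x}
    (hφ : IsEquivariantFamily φ) : ∃ ψ : ∀ x, B.stalk x →ₗ[ℚ] E.stalk x,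
      IsEquivariantFamily ψ ∧ ∀ x a, ψ x (i.app x a) = φ x a := by
  choose T hT hTi using fun r => exists_stabilizer_extension i hφ r (injective_of_mono i r)
  let rep : X → X := fun x => (Quotient.mk (MulAction.orbitRel G X) x).out
  have hrep : ∀ x, ∃ g : G, g • rep x = x := fun x =>
    MulAction.orbitRel_apply.1 ((MulAction.orbitRel G X).symm (Quotient.mk_out x))
  have hrep_smul : ∀ (g : G) {x y : X}, g • x = y → rep y = rep x := fun g x y h =>
    congrArg Quotient.out (Quotient.sound (s := MulAction.orbitRel G X)
      (MulAction.orbitRel_apply.2 ⟨g, h⟩))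
  choose γ hγ using hrep
  have hγ' : ∀ x, (γ x)⁻¹ • x = rep x := fun x => inv_smul_eq_iff.2 (hγ x).symm
  -- Two transports differ by the stabilizer element `g'⁻¹ * k * g`, with which `T r` commutes. The
  -- equality `r' = r` is a hypothesis so that it can be substituted: `rep y = rep x` is not
  -- definitional.
  have key : ∀ {r r' x y : X} (_ : r' = r) {g g' k : G} (hg : g • r = x) (hg' : g' • r' = y)
      (hk : k • x = y) (hi : g⁻¹ • x = r) (hi' : g'⁻¹ • y = r') (b : B.stalk x),
      E.act g' hg' (T r' (B.act g'⁻¹ hi' (B.act k hk b))) =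
        E.act k hk (E.act g hg (T r (B.act g⁻¹ hi b))) := by
    rintro _ r x y rfl g g' k hg hg' hk hi hi' b
    have hm : (g'⁻¹ * k * g) • r = r := by rw [mul_smul, mul_smul, hg, hk, hi']
    rw [act_act_eq B hk hi' hi hm (by group), hT]
    exact act_act_eq E _ _ _ _ (by group) _
  refine ⟨fun x => E.act (γ x) (hγ x) ∘ₗ T (rep x) ∘ₗ B.act (γ x)⁻¹ (hγ' x), ?_, ?_⟩
  · intro g x y h b
    exact key (hrep_smul g h) (hγ x) (hγ y) h (hγ' x) (hγ' y) b
  · intro x a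
    change E.act (γ x) (hγ x) (T (rep x) (B.act (γ x)⁻¹ (hγ' x) (i.app x a))) = φ x a
    rw [← i.equivariant, hTi, hφ,
      ← E.act_mul (hγ' x) (hγ x) (by rw [mul_smul, hγ', hγ]),
      act_congr E (mul_inv_cancel (γ x)) _ (one_smul G x), E.act_one]

/-- Evaluation turns the extension problem into one for equivariant families; `godementLift`
restores continuity. -/
instance injective_godement (E : RationalGSheaf G X) : Injective (godement E) where
  factors {A B} f i _ := by
    have hφ : IsEquivariantFamily fun x => godementEval E x ∘ₗ f.app x := fun g x y h e => by
      rw [LinearMap.comp_apply, f.equivariant, godementEval_equivariant]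
      rfl
    obtain ⟨ψ, hψ, h⟩ := exists_equivariant_extension i hφ
    exact ⟨godementLift hψ, (comp_godementLift i hψ hφ h).trans (godementLift_eval f hφ)⟩

end Extension

/-! ### Injective dimension and the Cantor–Bendixson process -/

section Dimension

variable {G : Type v} {X : Type u} [Group G] [TopologicalSpace G] [IsTopologicalGroup G]
  [CompactSpace G] [TopologicalSpace X] [T2Space X] [MulAction G X] [ContinuousSMul G X]

/-- The stalks of a rational `G`-sheaf vanish outside the set `S`. -/
def IsSupportedOn (E : RationalGSheaf G X) (S : Set X) : Prop :=
  ∀ x ∉ S, Subsingleton (E.stalk x)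

theorem isSupportedOn_coker_toGodement {E : RationalGSheaf G X} {S : Set X} (hS : IsClosed S)
    (hE : IsSupportedOn E S) :
    IsSupportedOn (coker (toGodement E)) (relDerivedSet S) := by
  intro x hx
  -- As `S` is closed, a point outside `relDerivedSet S`, whether in `S` or not, has a punctured
  -- neighbourhood missing `S`.
  rw [hS.relDerivedSet_eq, mem_derivedSet, accPt_iff_frequently_nhdsNE, not_frequently] at hx
  have : LinearMap.range ((toGodement E).app x) = ⊤ :=
    LinearMap.range_eq_top.2 (toGodement_surjective (hx.mono fun y hy => hE y hy))
  exact Submodule.Quotient.subsingleton_iff.2 this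

theorem shortExact_toGodement (E : RationalGSheaf G X) :
    (ShortComplex.mk (toGodement E) (cokerπ (toGodement E))
      (comp_cokerπ (toGodement E))).ShortExact where
  exact := ShortComplex.exact_of_g_is_cokernel _ (cokerIsColimit (toGodement E))
  mono_f := mono_toGodement E
  epi_g := Cofork.IsColimit.epi (cokerIsColimit (toGodement E))

theorem isClosed_cbStage (X : Type u) [TopologicalSpace X] (α : Ordinal.{u}) :
    IsClosed (cbStage X α) :=
  CantorBendixson.isClosed_iteratedDerivedSet isClosed_univ α

/-- Dimension shifting, with `m` counting the stages left before the support is empty. The bound is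
strict, so `m = 0` means that `E` is zero. -/
theorem hasInjectiveDimensionLT_of_isSupportedOn {n : ℕ} (hn : cbStage X n = ∅) (m k : ℕ)
    (hmk : k + m = n) (E : RationalGSheaf G X) (hE : IsSupportedOn E (cbStage X k)) :
    HasInjectiveDimensionLT E m := by
  induction m generalizing k E with
  | zero =>
    obtain rfl : k = n := hmk
    rw [hn] at hE
    apply IsZero.hasInjectiveDimensionLT_zero
    rw [IsZero.iff_id_eq_zero]
    ext x e
    have := hE x (Set.notMem_empty x)
    exact Subsingleton.elim _ _
  | succ m ih =>
    refine (shortExact_toGodement E).hasInjectiveDimensionLT_X₁ m (ih (k + 1) (by lia) _ ?_) ?_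
    · rw [Nat.cast_add_one, cbStage, CantorBendixson.iteratedDerivedSet_succ]
      exact isSupportedOn_coker_toGodement (isClosed_cbStage X k) hE
    · change HasInjectiveDimensionLT (godement E) (m + 1)
      -- An injective object has dimension less than `1`.
      exact hasInjectiveDimensionLT_of_ge _ 1 _ (by lia)

end Dimension

end EquivariantSheaf

/-! ### The bound on the homological dimension -/

/-- Adding `1` on the left avoids subtraction and covers `n = 0`, where the bound forces the value
`⊥`. -/
theorem mainTheorem7 (G : Type v) [Group G] [TopologicalSpace G] [IsTopologicalGroup G]
    [CompactSpace G] [T2Space G] [TotallyDisconnectedSpace G]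
    (X : Type u) [TopologicalSpace X] [CompactSpace X] [T2Space X] [TotallyDisconnectedSpace X]
    [MulAction G X] [ContinuousSMul G X]
    (hX : IsScatteredSpace X) (n : ℕ) (hn : cbRank X = (n : Ordinal.{u})) :
    homologicalDimension (RationalGSheaf G X) + 1 ≤ (n : WithBot ℕ∞) := by
  have hempty : cbStage X n = ∅ := by rw [← hn]; exact hX
  have hdim : ∀ E : RationalGSheaf G X, injectiveDimension E < (n : WithBot ℕ∞) := fun E => by
    refine injectiveDimension_lt_iff.2
      -- Stage `0` is the whole space, so the support condition is vacuous.
      (EquivariantSheaf.hasInjectiveDimensionLT_of_isSupportedOn hempty n 0 (zero_add n) E fun x hx => ?_)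
    simp [cbStage] at hx
  -- A supremum need not preserve strict bounds, so `< m + 1` is first turned into `≤ m`; for `n =
  -- 0` every term is `⊥`.
  cases n with
  | zero =>
    have : homologicalDimension (RationalGSheaf G X) = ⊥ := by
      refine iSup_eq_bot.2 fun E => ?_
      rw [injectiveDimension_eq_bot_iff, ← hasInjectiveDimensionLT_zero_iff_isZero,
        ← injectiveDimension_lt_iff]
      exact hdim E
    rw [this, WithBot.bot_add]
    exact bot_le
  | succ m =>
    have : homologicalDimension (RationalGSheaf G X) ≤ (m : WithBot ℕ∞) := iSup_le fun E => by
      rw [← ENat.WithBot.lt_add_one_iff]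
      exact_mod_cast hdim E
    push_cast
    gcongr
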